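/- Let $n\ge 1$ be an integer, and let $\widehat{\mathrm G}_0^n$ be the group, under composition, of formal diffeomorphisms of $(\mathbb C^n,0)$, that is, of $n$-tuples $f=(f_1,\dots,f_n)$ of formal power series $f_i\in\mathbb C[[x_1,\dots,x_n]]$ with $f(0)=0$ and $Df_{(0)}\in \mathrm{GL}(\mathbb C^n)$. Regard $\mathrm{GL}(\mathbb C^n)$ as the subgroup of linear maps in $\widehat{\mathrm G}_0^n$. For an automorphism $\tau$ of the field $\mathbb C$, let $\sigma^\tau$ be the automorphism of $\widehat{\mathrm G}_0^n$ obtained by applying $\tau$ to all the coefficients of the power series $f_i$. Then for every automorphism $\sigma$ of the (abstract) group $\widehat{\mathrm G}_0^n$ there exist $g\in\widehat{\mathrm G}_0^n$ and a field automorphism $\tau\in\mathrm{Aut}(\mathbb C,+,\cdot)$ such that $$ g\circ \sigma^\tau\big(\sigma(A)\big)\circ g^{-1}=A\qquad\text{for all } A\in \mathrm{GL}(\mathbb C^n). $$ In other words, up to conjugacy and up to the action of an element of $\mathrm{Aut}(\mathbb C,+,\cdot)$, the restriction of every element of $\mathrm{Aut}(\widehat{\mathrm G}_0^n)$ to $\mathrm{GL}(\mathbb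 C^n)$ is the identity map. -/

import Mathlib

noncomputable section

/-- `n`-tuples of formal power series in `n` variables over `ℂ`. -/
abbrev FormalTuple (n : ℕ) : Type := Fin n → MvPowerSeries (Fin n) ℂ

namespace FormalTuple

open MvPowerSeries

variable {n : ℕ}

/-- The Jacobian matrix at the origin, `∂fᵢ/∂xⱼ (0)`. -/
def jacobian (f : FormalTuple n) : Matrix (Fin n) (Fin n) ℂ :=
  Matrix.of fun i j => coeff (Finsupp.single j 1) (f i)

/-- The composition `f ∘ g`, obtained by substituting `g₁, …, gₙ` for the variables in each `fᵢ`.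
It is meaningful when the constant terms of `g` vanish. -/
def comp (f g : FormalTuple n) : FormalTuple n := fun i => subst g (f i)

/-- Power series of order at least `d`. -/
def orderIdeal (n d : ℕ) : Ideal (MvPowerSeries (Fin n) ℂ) where
  carrier := {p | (d : ℕ∞) ≤ p.order}
  add_mem' ha hb := le_trans (le_min ha hb) min_order_le_add
  zero_mem' := by simp
  smul_mem' c x hx := le_trans (le_trans hx le_add_self) (le_order_mul (f := c) (g := x))

theorem mem_orderIdeal {d : ℕ} {p : MvPowerSeries (Fin n) ℂ} :
    p ∈ orderIdeal n d ↔ (d : ℕ∞) ≤ p.order := Iff.rfl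

theorem mem_orderIdeal_iff_coeff {d : ℕ} {p : MvPowerSeries (Fin n) ℂ} :
    p ∈ orderIdeal n d ↔ ∀ e : Fin n →₀ ℕ, e.degree < d → coeff e p = 0 := by
  constructor
  · intro h e he
    exact coeff_of_lt_order (lt_of_lt_of_le (by exact_mod_cast he) (mem_orderIdeal.1 h))
  · intro h
    exact nat_le_order h

theorem mul_mem_orderIdeal {a b : ℕ} {p q : MvPowerSeries (Fin n) ℂ}
    (hp : p ∈ orderIdeal n a) (hq : q ∈ orderIdeal n b) : p * q ∈ orderIdeal n (a + b) := by
  rw [mem_orderIdeal] at *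
  push_cast
  exact le_trans (add_le_add hp hq) le_order_mul

theorem mem_orderIdeal_one {p : MvPowerSeries (Fin n) ℂ} :
    p ∈ orderIdeal n 1 ↔ constantCoeff p = 0 := by
  rw [mem_orderIdeal, Nat.cast_one, one_le_order_iff_constCoeff_eq_zero]

theorem monomial_sub_mem {d : ℕ} {g g' : FormalTuple n}
    (h : ∀ k, g k - g' k ∈ orderIdeal n d) (m : Fin n →₀ ℕ) :
    (m.prod fun s e => g s ^ e) - (m.prod fun s e => g' s ^ e) ∈ orderIdeal n d := by
  rw [← Ideal.Quotient.eq, map_finsuppProd, map_finsuppProd]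
  refine Finsupp.prod_congr fun k _ => ?_
  rw [map_pow, map_pow, Ideal.Quotient.eq.2 (h k)]

theorem monomial_mem_one {g : FormalTuple n} (hg : ∀ k, constantCoeff (g k) = 0)
    {m : Fin n →₀ ℕ} (hm : m ≠ 0) : (m.prod fun s e => g s ^ e) ∈ orderIdeal n 1 := by
  obtain ⟨k, hk⟩ := Finsupp.ne_iff.1 hm
  rw [mem_orderIdeal_one, map_finsuppProd]
  refine Finset.prod_eq_zero (i := k) (by simpa using hk) ?_
  beta_reduce
  rw [map_pow, hg k, zero_pow (by simpa using hk)]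

theorem monomial_sub_mem_succ {d : ℕ} {g g' : FormalTuple n}
    (hg : ∀ k, constantCoeff (g k) = 0) (hg' : ∀ k, constantCoeff (g' k) = 0)
    (h : ∀ k, g k - g' k ∈ orderIdeal n d) {m : Fin n →₀ ℕ} (hm0 : m ≠ 0)
    (hm1 : ∀ k, m ≠ Finsupp.single k 1) :
    (m.prod fun s e => g s ^ e) - (m.prod fun s e => g' s ^ e) ∈ orderIdeal n (d + 1) := by
  obtain ⟨k, hk⟩ := Finsupp.ne_iff.1 hm0
  have hk' : m k ≠ 0 := by simpa using hk
  obtain ⟨m', rfl⟩ : ∃ m', m = Finsupp.single k 1 + m' := by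
    refine ⟨m - Finsupp.single k 1, (add_tsub_cancel_of_le ?_).symm⟩
    rw [Finsupp.single_le_iff]
    omega
  have hm' : m' ≠ 0 := by
    rintro rfl
    exact hm1 k (by simp)
  have key : ∀ u : FormalTuple n, ((Finsupp.single k 1 + m').prod fun s e => u s ^ e) =
      u k * m'.prod fun s e => u s ^ e := by
    intro u
    rw [Finsupp.prod_add_index' (by simp) (fun _ _ _ => pow_add _ _ _)]
    simp
  rw [key, key]
  have e1 : ∀ a b a' b' : MvPowerSeries (Fin n) ℂ,
      a * b - a' * b' = a * (b - b') + (a - a') * b' := by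
    intros; ring
  rw [e1]
  refine add_mem ?_ (mul_mem_orderIdeal (h k) (monomial_mem_one hg' hm'))
  rw [add_comm d 1]
  exact mul_mem_orderIdeal (mem_orderIdeal_one.2 (hg k)) (monomial_sub_mem h m')

/-- First-order expansion of a substitution. -/
theorem coeff_subst_sub {d : ℕ} {g g' : FormalTuple n}
    (hg : ∀ k, constantCoeff (g k) = 0) (hg' : ∀ k, constantCoeff (g' k) = 0)
    (h : ∀ k, g k - g' k ∈ orderIdeal n d) (p : MvPowerSeries (Fin n) ℂ)
    (e : Fin n →₀ ℕ) (he : e.degree ≤ d) :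
    coeff e (subst g p) - coeff e (subst g' p) =
      ∑ k, coeff (Finsupp.single k 1) p * (coeff e (g k) - coeff e (g' k)) := by
  classical
  have sg := hasSubst_of_constantCoeff_zero hg
  have sg' := hasSubst_of_constantCoeff_zero hg'
  rw [coeff_subst sg, coeff_subst sg',
    ← finsum_sub_distrib (coeff_subst_finite sg p e) (coeff_subst_finite sg' p e)]
  have inj : Function.Injective fun k : Fin n => (Finsupp.single k 1 : Fin n →₀ ℕ) :=
    fun a b hab => Finsupp.single_left_injective one_ne_zero hab
  rw [finsum_eq_sum_of_support_subset (s := Finset.univ.image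
    fun k : Fin n => (Finsupp.single k 1 : Fin n →₀ ℕ)), Finset.sum_image (fun a _ b _ hab => inj hab)]
  · refine Finset.sum_congr rfl fun k _ => ?_
    simp [mul_sub]
  · intro m hm
    by_contra hcon
    apply hm
    have hm1 : ∀ k, m ≠ Finsupp.single k 1 := by
      rintro k rfl
      exact hcon (by simp)
    by_cases hm0 : m = 0
    · subst hm0
      simp
    · have := mem_orderIdeal_iff_coeff.1 (monomial_sub_mem_succ hg hg' h hm0 hm1) e (by omega)
      rw [map_sub] at this
      beta_reduce
      rw [← smul_sub, this, smul_zero]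

theorem constantCoeff_comp {f g : FormalTuple n} (hf : ∀ i, constantCoeff (f i) = 0)
    (hg : ∀ i, constantCoeff (g i) = 0) (i : Fin n) : constantCoeff (comp f g i) = 0 :=
  constantCoeff_subst_eq_zero (hasSubst_of_constantCoeff_zero hg) hg (hf i)

/-- The chain rule at the origin. -/
theorem jacobian_comp (f : FormalTuple n) {g : FormalTuple n}
    (hg : ∀ i, constantCoeff (g i) = 0) :
    jacobian (comp f g) = jacobian f * jacobian g := by
  ext i j
  have h := coeff_subst_sub (d := 1) (g' := 0) hg (by simp)
    (fun k => by simpa using mem_orderIdeal_one.2 (hg k)) (f i) (Finsupp.single j 1) (by simp)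
  rw [subst_zero_eq_C_constantCoeff] at h
  simpa [jacobian, comp, Matrix.mul_apply, coeff_C] using h

theorem jacobian_X : jacobian (fun i => X i : FormalTuple n) = 1 := by
  ext i j
  classical
  simp [jacobian, coeff_X, Matrix.one_apply, Finsupp.single_left_inj, eq_comm]

theorem comp_assoc (f : FormalTuple n) {g h : FormalTuple n}
    (hg : ∀ i, constantCoeff (g i) = 0) (hh : ∀ i, constantCoeff (h i) = 0) :
    comp (comp f g) h = comp f (comp g h) := by
  funext i
  exact subst_comp_subst_apply (hasSubst_of_constantCoeff_zero hg)
    (hasSubst_of_constantCoeff_zero hh) (f i)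

/-- One step of the successive approximation of a solution `g` of `f ∘ g = id`. -/
def step (f g : FormalTuple n) : FormalTuple n := fun i =>
  g i + ∑ j, (jacobian f)⁻¹ i j • (X j - comp f g j)

theorem constantCoeff_step {f g : FormalTuple n} (hf : ∀ i, constantCoeff (f i) = 0)
    (hg : ∀ i, constantCoeff (g i) = 0) (i : Fin n) : constantCoeff (step f g i) = 0 := by
  simp only [step, map_add, hg, map_sum, zero_add]
  refine Finset.sum_eq_zero fun j _ => ?_
  rw [constantCoeff_smul]
  simp [constantCoeff_comp hf hg]

theorem step_sub_mem {f : FormalTuple n} (hdet : IsUnit (jacobian f).det) {d : ℕ}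
    {g g' : FormalTuple n}
    (hg : ∀ k, constantCoeff (g k) = 0) (hg' : ∀ k, constantCoeff (g' k) = 0)
    (h : ∀ k, g k - g' k ∈ orderIdeal n d) (i : Fin n) :
    step f g i - step f g' i ∈ orderIdeal n (d + 1) := by
  rw [mem_orderIdeal_iff_coeff]
  intro e he
  have hv : ∀ j, coeff e (comp f g j) - coeff e (comp f g' j) =
      (jacobian f).mulVec (fun k => coeff e (g k) - coeff e (g' k)) j := fun j =>
    coeff_subst_sub hg hg' h (f j) e (by omega)
  have hw : (jacobian f)⁻¹.mulVec (fun j => coeff e (comp f g j) - coeff e (comp f g' j)) i =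
      coeff e (g i) - coeff e (g' i) := by
    rw [funext hv, Matrix.mulVec_mulVec, Matrix.nonsing_inv_mul _ hdet, Matrix.one_mulVec]
  have hs : ∀ u : FormalTuple n, coeff e (step f u i) = coeff e (u i) +
      ∑ j, (jacobian f)⁻¹ i j * (coeff e (X j : MvPowerSeries (Fin n) ℂ) -
        coeff e (comp f u j)) := by
    intro u
    simp [step]
  rw [map_sub, hs, hs]
  simp only [Matrix.mulVec, dotProduct] at hw
  simp only [mul_sub, Finset.sum_sub_distrib] at hw ⊢
  linear_combination -hw

/-- The successive approximations of a solution `g` of `f ∘ g = id`. -/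
def approx (f : FormalTuple n) : ℕ → FormalTuple n
  | 0 => 0
  | k + 1 => step f (approx f k)

theorem constantCoeff_approx {f : FormalTuple n} (hf : ∀ i, constantCoeff (f i) = 0) (k : ℕ) :
    ∀ i, constantCoeff (approx f k i) = 0 := by
  induction k with
  | zero => intro i; simp [approx]
  | succ k ih => exact constantCoeff_step hf ih

theorem approx_succ_sub_mem {f : FormalTuple n} (hf : ∀ i, constantCoeff (f i) = 0)
    (hdet : IsUnit (jacobian f).det) (k : ℕ) :
    ∀ i, approx f (k + 1) i - approx f k i ∈ orderIdeal n (k + 1) := by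
  induction k with
  | zero =>
    intro i
    rw [zero_add, mem_orderIdeal_one, map_sub, constantCoeff_approx hf, constantCoeff_approx hf,
      sub_zero]
  | succ k ih =>
    exact step_sub_mem hdet (constantCoeff_approx hf _) (constantCoeff_approx hf _) ih

theorem coeff_approx {f : FormalTuple n} (hf : ∀ i, constantCoeff (f i) = 0)
    (hdet : IsUnit (jacobian f).det) (i : Fin n) (e : Fin n →₀ ℕ) {k : ℕ} (hk : e.degree ≤ k) :
    coeff e (approx f k i) = coeff e (approx f e.degree i) := by
  induction k, hk using Nat.le_induction with
  | base => rfl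
  | succ k hk ih =>
    have := mem_orderIdeal_iff_coeff.1 (approx_succ_sub_mem hf hdet k i) e (by omega)
    rw [map_sub, sub_eq_zero] at this
    rw [this, ih]

/-- A tuple without constant terms and with invertible linear part has a right inverse for
composition. -/
theorem exists_right_inverse {f : FormalTuple n} (hf : ∀ i, constantCoeff (f i) = 0)
    (hdet : IsUnit (jacobian f).det) :
    ∃ g : FormalTuple n, (∀ i, constantCoeff (g i) = 0) ∧ comp f g = fun i => X i := by
  let g : FormalTuple n := fun i e => coeff e (approx f e.degree i)
  have hcg : ∀ i e, coeff e (g i) = coeff e (approx f e.degree i) := fun _ _ => rfl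
  have hg : ∀ i, constantCoeff (g i) = 0 := by
    intro i
    rw [← coeff_zero_eq_constantCoeff_apply, hcg]
    simp [approx]
  have hga : ∀ k i, g i - approx f k i ∈ orderIdeal n (k + 1) := by
    intro k i
    rw [mem_orderIdeal_iff_coeff]
    intro e he
    rw [map_sub, hcg, coeff_approx hf hdet i e (k := k) (by omega), sub_self]
  have hfix : ∀ i, step f g i = g i := by
    intro i
    ext e
    have h1 := step_sub_mem hdet hg (constantCoeff_approx hf e.degree) (hga e.degree) i
    have h1 := mem_orderIdeal_iff_coeff.1 h1 e (by omega)
    have h2 := mem_orderIdeal_iff_coeff.1 (hga (e.degree + 1) i) e (by omega)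
    rw [map_sub, sub_eq_zero] at h1 h2
    rw [h1, h2]
    rfl
  refine ⟨g, hg, ?_⟩
  funext i
  ext e
  have hz : (jacobian f)⁻¹.mulVec
      (fun j => coeff e (X j : MvPowerSeries (Fin n) ℂ) - coeff e (comp f g j)) = 0 := by
    funext l
    have h := congrArg (coeff e) (hfix l)
    simpa [step, Matrix.mulVec, dotProduct] using h
  have hz' := congrArg (jacobian f).mulVec hz
  rw [Matrix.mulVec_mulVec, Matrix.mul_nonsing_inv _ hdet, Matrix.one_mulVec,
    Matrix.mulVec_zero] at hz'
  exact (sub_eq_zero.1 (congrFun hz' i)).symm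

end FormalTuple

/-- Formal diffeomorphisms of `(ℂⁿ, 0)`: `n`-tuples of formal power series in `n` variables, without
constant terms and with invertible linear part. -/
@[ext]
structure FormalDiffeo (n : ℕ) where
  /-- The components. -/
  toTuple : FormalTuple n
  constantCoeff_eq_zero : ∀ i, MvPowerSeries.constantCoeff (toTuple i) = 0
  isUnit_det_jacobian : IsUnit (FormalTuple.jacobian toTuple).det

namespace FormalDiffeo

open MvPowerSeries

variable {n : ℕ}

instance : One (FormalDiffeo n) where
  one := ⟨fun i => X i, fun i => by simp, by rw [FormalTuple.jacobian_X]; simp⟩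

/-- The product of formal diffeomorphisms is their composition `f ∘ g`. -/
instance : Mul (FormalDiffeo n) where
  mul f g := ⟨FormalTuple.comp f.toTuple g.toTuple,
    FormalTuple.constantCoeff_comp f.constantCoeff_eq_zero g.constantCoeff_eq_zero, by
      rw [FormalTuple.jacobian_comp _ g.constantCoeff_eq_zero, Matrix.det_mul]
      exact f.isUnit_det_jacobian.mul g.isUnit_det_jacobian⟩

theorem toTuple_one : (1 : FormalDiffeo n).toTuple = fun i => X i := rfl

theorem toTuple_mul (f g : FormalDiffeo n) :
    (f * g).toTuple = FormalTuple.comp f.toTuple g.toTuple := rfl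

theorem exists_mul_eq_one (f : FormalDiffeo n) : ∃ g : FormalDiffeo n, f * g = 1 := by
  obtain ⟨g, hg, hfg⟩ :=
    FormalTuple.exists_right_inverse f.constantCoeff_eq_zero f.isUnit_det_jacobian
  refine ⟨⟨g, hg, ?_⟩, FormalDiffeo.ext hfg⟩
  have h := FormalTuple.jacobian_comp f.toTuple hg
  rw [hfg, FormalTuple.jacobian_X] at h
  exact Matrix.isUnit_det_of_left_inverse h.symm

instance : Inv (FormalDiffeo n) where
  inv f := Classical.choose f.exists_mul_eq_one

/-- The group of formal diffeomorphisms under composition. -/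
instance : Group (FormalDiffeo n) :=
  Group.ofRightAxioms
    (fun f g h => FormalDiffeo.ext
      (FormalTuple.comp_assoc f.toTuple g.constantCoeff_eq_zero h.constantCoeff_eq_zero))
    (fun f => FormalDiffeo.ext (by
      rw [toTuple_mul, toTuple_one]
      funext i
      change subst X (f.toTuple i) = f.toTuple i
      rw [subst_self]
      rfl))
    (fun f => Classical.choose_spec f.exists_mul_eq_one)

/-- An invertible matrix `A` seen as the linear formal diffeomorphism `x ↦ A x`; this is the
embedding of `GL(ℂⁿ)` into the group of formal diffeomorphisms. -/
def linear (n : ℕ) : Matrix.GeneralLinearGroup (Fin n) ℂ →* FormalDiffeo n where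
  toFun A := ⟨fun i => ∑ j, (A : Matrix (Fin n) (Fin n) ℂ) i j • X j,
    fun i => by simp [constantCoeff_smul], by
      have h : FormalTuple.jacobian (fun i => ∑ j, (A : Matrix (Fin n) (Fin n) ℂ) i j • X j) =
          (A : Matrix (Fin n) (Fin n) ℂ) := by
        classical
        ext i j
        simp [FormalTuple.jacobian, coeff_X, Finsupp.single_left_inj]
      rw [h]
      exact (Matrix.isUnit_iff_isUnit_det _).1 A.isUnit⟩
  map_one' := by
    classical
    refine FormalDiffeo.ext (funext fun i => ?_)
    simp [toTuple_one, Matrix.one_apply]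
  map_mul' A B := by
    refine FormalDiffeo.ext (funext fun i => ?_)
    have hs : HasSubst (fun i => ∑ j, (B : Matrix (Fin n) (Fin n) ℂ) i j • X j : FormalTuple n) :=
      hasSubst_of_constantCoeff_zero fun i => by simp [constantCoeff_smul]
    rw [toTuple_mul, FormalTuple.comp, ← substAlgHom_apply hs, map_sum]
    simp only [map_smul, substAlgHom_X, Units.val_mul, Matrix.mul_apply, Finset.sum_smul,
      Finset.smul_sum, smul_smul]
    exact Finset.sum_comm

/-- Applying a field automorphism of `ℂ` to every coefficient of a formal diffeomorphism. -/
def mapCoeff (τ : ℂ ≃+* ℂ) (f : FormalDiffeo n) : FormalDiffeo n where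
  toTuple i := MvPowerSeries.map (τ : ℂ →+* ℂ) (f.toTuple i)
  constantCoeff_eq_zero i := by simp [f.constantCoeff_eq_zero i]
  isUnit_det_jacobian := by
    have h : FormalTuple.jacobian (fun i => MvPowerSeries.map (τ : ℂ →+* ℂ) (f.toTuple i)) =
        (τ : ℂ →+* ℂ).mapMatrix (FormalTuple.jacobian f.toTuple) := by
      ext i j
      simp [FormalTuple.jacobian]
    rw [h, ← RingHom.map_det]
    exact f.isUnit_det_jacobian.map _

/-- The automorphism of the group of formal diffeomorphisms induced by a field automorphism `τ`
of `ℂ`, acting on the coefficients. -/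
def fieldAut (n : ℕ) (τ : ℂ ≃+* ℂ) : MulAut (FormalDiffeo n) where
  toFun := mapCoeff τ
  invFun := mapCoeff τ.symm
  left_inv f := by
    refine FormalDiffeo.ext (funext fun i => ?_)
    ext e
    simp [mapCoeff]
  right_inv f := by
    refine FormalDiffeo.ext (funext fun i => ?_)
    ext e
    simp [mapCoeff]
  map_mul' f g := by
    refine FormalDiffeo.ext (funext fun i => ?_)
    exact map_subst (hasSubst_of_constantCoeff_zero g.constantCoeff_eq_zero) (f.toTuple i)

end FormalDiffeo

end

/-! Let δ be the dilation x ↦ 2x. Since 2^d ≠ 2 for d ≥ 2, for every f tangent to the identity the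
equation δ f g = g δ is solved degree by degree by some g tangent to the identity. Apply σ, and let
M and q be the linear parts of σ(δ) and σ(f): M q is conjugate to M, and so is M q' for every
conjugate q' of q. Comparing traces (`mem_center_or_mem_center_of_trace`) shows that M or q is
scalar; commutators with δ exclude a nonscalar M. Then q = 1, so σ preserves tangency to the
identity.

The ratio u of M is detected by δ f g² = g δ. With δ itself, it forces f to have no quadratic part;
with σ(δ) in place of δ, it is always solvable unless some u^k with k ≥ 1 is 2. The same holds for
σ⁻¹, and together they give u = 2. Hence σ(δ) is linearizable, and after a conjugation σ fixes δ. It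
then preserves the centralizer of δ, which is GL, the centre of GL, which consists of the
homotheties, and the diffeomorphisms equal to the identity up to degree 2. So σ acts additively on
quadratic parts. The homothety of ratio u acts there by the scalar u⁻¹, so the action of σ on ratios
is additive as well as multiplicative: it is a field automorphism τ.

Once τ is undone, σ induces a linear map on quadratic vector fields that intertwines A with α(A),
where α is the restriction of σ to GL. Its composite with the divergence is a nonzero Θ with values
in covectors. Were Θ nonzero on some v ⊗ l² with l(v) = 0, transvections would have to act on the
target with (T − 1)² = 0, whereas the orbit of v ⊗ l² is cubic (`Equivariant.apply_tens_eq_zero`).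
So Θ lives on the trace part, a copy of the covectors, and yields an invertible P intertwining A and
α(A): α is inner. -/

/-! ### Rank-one perturbations of the identity and central matrices -/

open Matrix in
/-- The invertible matrix `1 + u φᵀ`. -/
noncomputable def rankOneGL {n : ℕ} (u φ : Fin n → ℂ) (h : 1 + φ ⬝ᵥ u ≠ 0) :
    Matrix.GeneralLinearGroup (Fin n) ℂ where
  val := 1 + vecMulVec u φ
  inv := 1 - (1 + φ ⬝ᵥ u)⁻¹ • vecMulVec u φ
  val_inv := by
    have e : vecMulVec u φ * vecMulVec u φ = (φ ⬝ᵥ u) • vecMulVec u φ := by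
      rw [vecMulVec_mul_vecMulVec, vecMulVec_smul]
    have hc : (1 + φ ⬝ᵥ u)⁻¹ * (1 + φ ⬝ᵥ u) = 1 := inv_mul_cancel₀ h
    simp only [add_mul, mul_sub, Matrix.mul_smul, e, one_mul, mul_one]
    match_scalars
    · ring
    · linear_combination -hc
  inv_val := by
    have e : vecMulVec u φ * vecMulVec u φ = (φ ⬝ᵥ u) • vecMulVec u φ := by
      rw [vecMulVec_mul_vecMulVec, vecMulVec_smul]
    have hc : (1 + φ ⬝ᵥ u)⁻¹ * (1 + φ ⬝ᵥ u) = 1 := inv_mul_cancel₀ h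
    simp only [sub_mul, mul_add, Matrix.smul_mul, e, one_mul, mul_one]
    match_scalars
    · ring
    · linear_combination -hc

namespace rankOneGL

open Matrix

variable {n : ℕ} {u φ : Fin n → ℂ} (h : 1 + φ ⬝ᵥ u ≠ 0)

theorem mulVec (v : Fin n → ℂ) :
    (rankOneGL u φ h : Matrix (Fin n) (Fin n) ℂ) *ᵥ v = v + (φ ⬝ᵥ v) • u := by
  change (1 + vecMulVec u φ) *ᵥ v = _
  rw [add_mulVec, one_mulVec, vecMulVec_mulVec]
  simp

theorem vecMul_inv (l : Fin n → ℂ) :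
    l ᵥ* ((rankOneGL u φ h)⁻¹ : GL (Fin n) ℂ) = l - ((1 + φ ⬝ᵥ u)⁻¹ * (l ⬝ᵥ u)) • φ := by
  change l ᵥ* (1 - (1 + φ ⬝ᵥ u)⁻¹ • vecMulVec u φ) = _
  rw [vecMul_sub, vecMul_one, vecMul_smul, vecMul_vecMulVec, smul_smul]

theorem vecMul (l : Fin n → ℂ) :
    l ᵥ* (rankOneGL u φ h : Matrix (Fin n) (Fin n) ℂ) = l + (l ⬝ᵥ u) • φ := by
  change l ᵥ* (1 + vecMulVec u φ) = _
  rw [vecMul_add, vecMul_one, vecMul_vecMulVec]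

theorem inv_mulVec (v : Fin n → ℂ) :
    ((rankOneGL u φ h)⁻¹ : GL (Fin n) ℂ).1 *ᵥ v = v - ((1 + φ ⬝ᵥ u)⁻¹ * (φ ⬝ᵥ v)) • u := by
  change (1 - (1 + φ ⬝ᵥ u)⁻¹ • vecMulVec u φ) *ᵥ v = _
  rw [sub_mulVec, one_mulVec, smul_mulVec, vecMulVec_mulVec]
  simp [smul_smul]

end rankOneGL

namespace Matrix

variable {n : ℕ}

/-- The permutation matrices are invertible. -/
def permGL (s : Equiv.Perm (Fin n)) : GL (Fin n) ℂ where
  val := s.toPEquiv.toMatrix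
  inv := s.symm.toPEquiv.toMatrix
  val_inv := by
    rw [← PEquiv.toMatrix_trans, ← Equiv.toPEquiv_trans]; simp
  inv_val := by
    rw [← PEquiv.toMatrix_trans, ← Equiv.toPEquiv_trans]; simp

/-- A matrix all of whose conjugates have a vanishing entry at a fixed place off the diagonal is
central. -/
theorem mem_center_of_forall_conj_apply_eq_zero {M : GL (Fin n) ℂ} {i j : Fin n} (hij : i ≠ j)
    (h : ∀ A : GL (Fin n) ℂ, (A * M * A⁻¹).1 i j = 0) :
    M ∈ Subgroup.center (GL (Fin n) ℂ) := by
  have off : ∀ (N : GL (Fin n) ℂ), (∀ A : GL (Fin n) ℂ, (A * N * A⁻¹).1 i j = 0) →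
      ∀ k l, k ≠ l → N.1 k l = 0 := by
    intro N hN k l hkl
    obtain ⟨s, hsi, hsj⟩ : ∃ s : Equiv.Perm (Fin n), s i = k ∧ s j = l := by
      refine ⟨(Equiv.swap i k).trans (Equiv.swap (Equiv.swap i k j) l), ?_, ?_⟩
      · rw [Equiv.trans_apply, Equiv.swap_apply_left]
        refine Equiv.swap_apply_of_ne_of_ne ?_ hkl
        intro e
        apply hij
        apply (Equiv.swap i k).injective
        rw [← e, Equiv.swap_apply_left]
      · simp
    have := hN (permGL s)
    change (s.toPEquiv.toMatrix * N.1 * s.symm.toPEquiv.toMatrix : Matrix _ _ ℂ) i j = 0 at this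
    rw [PEquiv.toMatrix_toPEquiv_mul, PEquiv.mul_toMatrix_toPEquiv] at this
    simpa [hsi, hsj] using this
  have hd := off M h
  rw [GeneralLinearGroup.mem_center_iff_val_mem_range_scalar]
  refine ⟨M.1 i i, ?_⟩
  ext k l
  by_cases hkl : k = l
  · subst hkl
    by_cases hik : i = k
    · subst hik; simp
    · have hn : (1 : ℂ) + (Pi.single k 1 : Fin n → ℂ) ⬝ᵥ Pi.single i 1 ≠ 0 := by
        simp [Ne.symm hik]
      -- With M diagonal, the (i, k) entry of its conjugate by 1 + E_ik is M_kk − M_ii.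
      have h2 := off (rankOneGL (Pi.single i 1) (Pi.single k 1) hn * M *
        (rankOneGL (Pi.single i 1) (Pi.single k 1) hn)⁻¹) (fun A => by
          have := h (A * rankOneGL (Pi.single i 1) (Pi.single k 1) hn)
          simpa only [_root_.mul_inv_rev, mul_assoc] using this) i k hik
      have e : ∀ (P Q : Matrix (Fin n) (Fin n) ℂ),
          (P * M.1 * Q) i k = (Pi.single i 1 ᵥ* P) ⬝ᵥ (M.1 *ᵥ (Q *ᵥ Pi.single k 1)) := by
        intro P Q
        rw [← dotProduct_mulVec, mulVec_mulVec, mulVec_mulVec]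
        simp
      change (_ * M.1 * _ : Matrix _ _ ℂ) i k = 0 at h2
      rw [e, rankOneGL.vecMul, rankOneGL.inv_mulVec] at h2
      have h3 := hd i k hik
      have h4 := hd k i (Ne.symm hik)
      simp [Matrix.mulVec_sub, h3, h4, sub_eq_zero, hik] at h2
      simp [h2]
  · simp [hd k l hkl, hkl]

/-- If `tr (M A q A⁻¹) = tr M` for all `A`, then `M` or `q` is central. -/
theorem mem_center_or_mem_center_of_trace {M q : GL (Fin n) ℂ}
    (h : ∀ A : GL (Fin n) ℂ, (M * (A * q * A⁻¹)).1.trace = M.1.trace) :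
    M ∈ Subgroup.center (GL (Fin n) ℂ) ∨ q ∈ Subgroup.center (GL (Fin n) ℂ) := by
  by_cases hq : q ∈ Subgroup.center (GL (Fin n) ℂ)
  · exact Or.inr hq
  left
  by_cases hn : ∃ i j : Fin n, i ≠ j
  swap
  · rw [GeneralLinearGroup.mem_center_iff_val_mem_range_scalar]
    push Not at hn
    rcases n with _ | n
    · exact ⟨0, Subsingleton.elim _ _⟩
    · refine ⟨M.1 0 0, ?_⟩
      ext i j
      rw [hn i 0, hn j 0]
      simp
  obtain ⟨i, j, hij⟩ := hn
  -- Fix a conjugate p of q with p_ij ≠ 0; it then suffices that N_ij = 0 for every conjugate N of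
  -- M.
  obtain ⟨A, hA⟩ : ∃ A : GL (Fin n) ℂ, (A * q * A⁻¹).1 i j ≠ 0 := by
    by_contra hcon
    push Not at hcon
    exact hq (mem_center_of_forall_conj_apply_eq_zero hij hcon)
  refine mem_center_of_forall_conj_apply_eq_zero hij fun B => ?_
  set p := A * q * A⁻¹ with hp
  set N := B * M * B⁻¹ with hN
  have hpN : ∀ C : GL (Fin n) ℂ, (N * (C * p * C⁻¹)).1.trace = M.1.trace := by
    intro C
    rw [← h (B⁻¹ * C * A)]
    have e : N * (C * p * C⁻¹) = B * (M * (B⁻¹ * C * A * q * (B⁻¹ * C * A)⁻¹)) * B⁻¹ := by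
      rw [hN, hp]
      group
    rw [e, Units.val_mul, trace_mul_comm, ← Units.val_mul, inv_mul_cancel_left]
  clear_value p N
  have hs : ∀ s : ℂ, (1 : ℂ) + (Pi.single i 1 : Fin n → ℂ) ⬝ᵥ (s • Pi.single j 1) = 1 := by
    intro s
    simp [hij]
  -- Conjugating p by 1 + s E_ji gives a trace that is polynomial in s yet constant. Its s²
  -- coefficient is −N_ij p_ij, because E p E = p_ij E; the values s = 0, 1, −1 isolate it.
  have key : ∀ s : ℂ, (N.1 * p.1).trace + s * (N.1 * (vecMulVec (Pi.single j 1) (Pi.single i 1) * p.1 -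
      p.1 * vecMulVec (Pi.single j 1) (Pi.single i 1))).trace - s ^ 2 * (N.1 i j * p.1 i j) =
        M.1.trace := by
    intro s
    rw [← hpN (rankOneGL (s • Pi.single j 1) (Pi.single i 1) (by rw [hs]; exact one_ne_zero))]
    set E : Matrix (Fin n) (Fin n) ℂ := vecMulVec (Pi.single j 1) (Pi.single i 1) with hE
    have hr : (rankOneGL (s • Pi.single j 1) (Pi.single i 1) (by rw [hs]; exact one_ne_zero) :
        Matrix (Fin n) (Fin n) ℂ) = 1 + s • E := by
      rw [hE, ← smul_vecMulVec]
      rfl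
    have hri : ((rankOneGL (s • Pi.single j 1) (Pi.single i 1) (by rw [hs]; exact one_ne_zero))⁻¹ :
        GL (Fin n) ℂ).1 = 1 - s • E := by
      change (1 - ((1 : ℂ) + Pi.single i 1 ⬝ᵥ s • Pi.single j 1)⁻¹ •
        vecMulVec (s • Pi.single j 1) (Pi.single i 1) : Matrix (Fin n) (Fin n) ℂ) = _
      rw [hs, inv_one, one_smul, smul_vecMulVec]
    rw [Units.val_mul, Units.val_mul, Units.val_mul, hr, hri]
    have hEpE : E * p.1 * E = p.1 i j • E := by
      rw [hE, vecMulVec_mul, vecMulVec_mul_vecMulVec, vecMulVec_smul]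
      simp
    have hNE : (N.1 * E).trace = N.1 i j := by
      rw [hE, mul_vecMulVec, trace_vecMulVec]
      simp
    have : N.1 * ((1 + s • E) * p.1 * (1 - s • E)) = N.1 * p.1 + s • (N.1 * (E * p.1 - p.1 * E)) -
        s ^ 2 • (N.1 * (E * p.1 * E)) := by
      simp only [add_mul, mul_sub, one_mul, mul_one, Matrix.smul_mul, Matrix.mul_smul, mul_add,
        Matrix.mul_assoc]
      module
    rw [this, hEpE, trace_sub, trace_add, trace_smul, trace_smul, Matrix.mul_smul, trace_smul, hNE]
    simp [mul_comm]
  have h0 := key 0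
  have h1 := key 1
  have h2 := key (-1)
  have : N.1 i j * p.1 i j = 0 := by linear_combination h0 - (1/2) * h1 - (1/2) * h2
  exact (mul_eq_zero.1 this).resolve_right hA

end Matrix

/-! ### Equivariant maps from quadratic vector fields to covectors -/

/-- Tuples of bilinear forms, the coefficients of quadratic vector fields. -/
abbrev BilinTuple (n : ℕ) : Type := Fin n → Matrix (Fin n) (Fin n) ℂ

namespace BilinTuple

open Matrix

variable {n : ℕ}

/-- The decomposable element `v ⊗ l ⊗ m`. -/
def tens (v l m : Fin n → ℂ) : BilinTuple n := fun i => v i • vecMulVec l m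

theorem tens_add_left (v v' l m : Fin n → ℂ) : tens (v + v') l m = tens v l m + tens v' l m := by
  funext i
  simp [tens, add_smul]

theorem tens_smul_left (a : ℂ) (v l m : Fin n → ℂ) : tens (a • v) l m = a • tens v l m := by
  funext i
  simp [tens, mul_smul]

theorem tens_add_middle (v l l' m : Fin n → ℂ) : tens v (l + l') m = tens v l m + tens v l' m := by
  funext i
  simp [tens, add_vecMulVec]

theorem tens_smul_middle (a : ℂ) (v l m : Fin n → ℂ) : tens v (a • l) m = a • tens v l m := by
  funext i
  simp [tens, smul_vecMulVec, smul_comm a]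

theorem tens_add_right (v l m m' : Fin n → ℂ) : tens v l (m + m') = tens v l m + tens v l m' := by
  funext i
  simp [tens, vecMulVec_add]

theorem tens_smul_right (a : ℂ) (v l m : Fin n → ℂ) : tens v l (a • m) = a • tens v l m := by
  funext i
  simp [tens, vecMulVec_smul, smul_comm a]

theorem eq_sum_tens (w : BilinTuple n) : w = ∑ i, ∑ j, ∑ k, w i j k •
    tens (Pi.single i 1) (Pi.single j 1) (Pi.single k 1) := by
  funext a
  ext b c
  simp only [tens, Finset.sum_apply, Matrix.sum_apply, Pi.smul_apply, Matrix.smul_apply,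
    vecMulVec_apply, smul_eq_mul]
  simp [Pi.single_apply]

/-- Equivariance on decomposable elements, with respect to the action of the linear group on the
source and its twist by `α` on the target. -/
def Equivariant (α : GL (Fin n) ℂ →* GL (Fin n) ℂ) (Θ : BilinTuple n →ₗ[ℂ] (Fin n → ℂ)) : Prop :=
  ∀ (A : GL (Fin n) ℂ) (v l m : Fin n → ℂ),
    Θ (tens (A.1 *ᵥ v) (l ᵥ* (A⁻¹).1) (m ᵥ* (A⁻¹).1)) = Θ (tens v l m) ᵥ* ((α A)⁻¹).1

variable {α : GL (Fin n) ℂ →* GL (Fin n) ℂ} {Θ : BilinTuple n →ₗ[ℂ] (Fin n → ℂ)}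

/-- A coordinate form not killing v works, doubled when 1 + v'_i = 0. The second condition is what
makes 1 + v' φᵀ invertible. -/
theorem exists_dotProduct_ne_zero {v v' : Fin n → ℂ} (hv : v ≠ 0) :
    ∃ φ : Fin n → ℂ, φ ⬝ᵥ v ≠ 0 ∧ 1 + φ ⬝ᵥ v' ≠ 0 := by
  obtain ⟨i, hi⟩ := Function.ne_iff.1 hv
  have hi : v i ≠ 0 := hi
  by_cases h : 1 + v' i = 0
  · refine ⟨(2 : ℂ) • Pi.single i 1, by simpa using hi, ?_⟩
    have : v' i = -1 := by linear_combination h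
    simp [this]
    norm_num
  · exact ⟨Pi.single i 1, by simpa using hi, by simpa using h⟩

/-- The case where some `l² v` with `l v = 0` is not killed: transvections act quadratically. -/
theorem Equivariant.unipotent_sq (hΘ : Equivariant α Θ) {v l : Fin n → ℂ} (hlv : l ⬝ᵥ v = 0)
    (h0 : Θ (tens v l l) ≠ 0) (h : 1 + l ⬝ᵥ v ≠ 0) (y : Fin n → ℂ) :
    (y ᵥ* ((α (rankOneGL v l h))⁻¹).1) ᵥ* ((α (rankOneGL v l h))⁻¹).1 -
      (2 : ℂ) • (y ᵥ* ((α (rankOneGL v l h))⁻¹).1) + y = 0 := by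
  let f : (Fin n → ℂ) →ₗ[ℂ] (Fin n → ℂ) :=
    { toFun := fun u => Θ (tens u l l)
      map_add' := fun a b => by rw [tens_add_left, map_add]
      map_smul' := fun a b => by rw [tens_smul_left, map_smul]; rfl }
  -- The matrix 1 + v φᵀ fixes l, since l v = 0, and sends u to u + φ(u) v. A nonzero u in the
  -- kernel would therefore put v in the kernel as well. Injectivity gives surjectivity by equality
  -- of dimensions, so the target is the u-space, on which 1 + v lᵀ acts with (T − 1)² = 0.
  have hf : Function.Injective f := by
    rw [injective_iff_map_eq_zero]
    intro u hu
    by_contra hne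
    obtain ⟨φ, h1, h2⟩ := exists_dotProduct_ne_zero (v' := v) hne
    have := hΘ (rankOneGL v φ h2) u l l
    rw [rankOneGL.mulVec, rankOneGL.vecMul_inv, hlv] at this
    simp only [mul_zero, zero_smul, sub_zero] at this
    change f (u + (φ ⬝ᵥ u) • v) = f u ᵥ* _ at this
    rw [map_add, hu, zero_vecMul, map_smul, zero_add] at this
    exact (smul_ne_zero h1 h0) this
  obtain ⟨u, rfl⟩ := LinearMap.injective_iff_surjective.1 hf y
  have step : ∀ u, f u ᵥ* ((α (rankOneGL v l h))⁻¹).1 = f u + (l ⬝ᵥ u) • f v := by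
    intro u
    rw [← map_smul, ← map_add]
    have := hΘ (rankOneGL v l h) u l l
    rw [rankOneGL.mulVec, rankOneGL.vecMul_inv, hlv] at this
    simp only [mul_zero, zero_smul, sub_zero] at this
    exact this.symm
  rw [step, add_vecMul, smul_vecMul, step, step, hlv]
  module

/-- Such elements are highest weight vectors. Along the transvection 1 + v1 l1ᵀ the element v ⊗ l²
moves on the cubic curve (v + s v1) ⊗ (l − s l1)², with leading term v1 ⊗ l1². By `unipotent_sq` the
image of this transvection kills second differences, hence third differences, so the leading term is
killed too. -/
theorem Equivariant.apply_tens_eq_zero (hΘ : Equivariant α Θ) {v l : Fin n → ℂ}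
    (hlv : l ⬝ᵥ v = 0) : Θ (tens v l l) = 0 := by
  by_contra h0
  have hv : v ≠ 0 := by
    rintro rfl
    apply h0
    have := tens_smul_left 0 0 l l
    rw [zero_smul, zero_smul] at this
    rw [this, map_zero]
  have hl : l ≠ 0 := by
    rintro rfl
    apply h0
    have := tens_smul_middle 0 v 0 0
    rw [zero_smul, zero_smul] at this
    rw [this, map_zero]
  obtain ⟨v1, hv1⟩ : ∃ v1, l ⬝ᵥ v1 = 1 := by
    obtain ⟨i, hi⟩ := Function.ne_iff.1 hl
    have hi : l i ≠ 0 := hi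
    exact ⟨Pi.single i (l i)⁻¹, by simp [hi]⟩
  obtain ⟨l1, hl1, hl1'⟩ : ∃ l1, l1 ⬝ᵥ v = 1 ∧ l1 ⬝ᵥ v1 = 0 := by
    obtain ⟨i, hi⟩ := Function.ne_iff.1 hv
    have hi : v i ≠ 0 := hi
    refine ⟨Pi.single i (v i)⁻¹ - (Pi.single i (v i)⁻¹ ⬝ᵥ v1) • l, ?_, ?_⟩
    · rw [sub_dotProduct, smul_dotProduct, hlv]
      simp [hi]
    · rw [sub_dotProduct, smul_dotProduct, hv1]
      simp
  have hS : (1 : ℂ) + (l - l1) ⬝ᵥ (v - v1) = -1 := by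
    rw [sub_dotProduct, dotProduct_sub, dotProduct_sub, hlv, hv1, hl1, hl1']
    norm_num
  -- The reflection 1 + (v − v1)(l − l1)ᵀ exchanges v with v1 and l with l1, so nonvanishing carries
  -- over.
  have h1 : Θ (tens v1 l1 l1) ≠ 0 := by
    have hne : (1 : ℂ) + (l - l1) ⬝ᵥ (v - v1) ≠ 0 := by rw [hS]; norm_num
    have := hΘ (rankOneGL (v - v1) (l - l1) hne) v l l
    rw [rankOneGL.mulVec, rankOneGL.vecMul_inv, hS] at this
    have e1 : v + ((l - l1) ⬝ᵥ v) • (v - v1) = v1 := by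
      rw [sub_dotProduct, hlv, hl1]
      module
    have e2 : l - ((-1)⁻¹ * (l ⬝ᵥ (v - v1))) • (l - l1) = l1 := by
      rw [dotProduct_sub, hlv, hv1]
      norm_num
    rw [e1, e2] at this
    rw [this]
    intro hz
    apply h0
    have h2 := congrArg (fun z => z ᵥ* (α (rankOneGL (v - v1) (l - l1) hne)).1) hz
    simpa [vecMul_vecMul, ← Units.val_mul] using h2
  have hA : (1 : ℂ) + l1 ⬝ᵥ v1 ≠ 0 := by rw [hl1']; norm_num
  have step : ∀ u k, Θ (tens u k k) ᵥ* ((α (rankOneGL v1 l1 hA))⁻¹).1 =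
      Θ (tens (u + (l1 ⬝ᵥ u) • v1) (k - (k ⬝ᵥ v1) • l1) (k - (k ⬝ᵥ v1) • l1)) := by
    intro u k
    rw [← hΘ, rankOneGL.mulVec, rankOneGL.vecMul_inv, hl1', add_zero, inv_one, one_mul]
  have step1 : ∀ s : ℂ, Θ (tens (v + s • v1) (l - s • l1) (l - s • l1)) ᵥ*
      ((α (rankOneGL v1 l1 hA))⁻¹).1 =
      Θ (tens (v + (s + 1) • v1) (l - (s + 1) • l1) (l - (s + 1) • l1)) := by
    intro s
    rw [step]
    congr 2
    · rw [dotProduct_add, dotProduct_smul, hl1, hl1']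
      module
    all_goals
      rw [sub_dotProduct, smul_dotProduct, hv1, hl1']
      module
  have sq := fun s : ℂ => hΘ.unipotent_sq hl1' h1 hA
    (Θ (tens (v + s • v1) (l - s • l1) (l - s • l1)))
  simp only [step1] at sq
  have s0 := sq 0
  have s1 := sq 1
  simp only [sub_eq_add_neg, ← neg_smul, tens_add_left, tens_add_middle, tens_add_right,
    tens_smul_left, tens_smul_middle, tens_smul_right, map_add, map_smul] at s0 s1
  apply h1
  -- The difference of the second differences at s = 1 and s = 0 is the third difference, 3! times
  -- the leading coefficient.
  have h6 : (6 : ℂ) • Θ (tens v1 l1 l1) = 0 := by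
    have := s1.trans s0.symm
    rw [← sub_eq_zero] at this
    rw [← this]
    module
  exact (smul_eq_zero.1 h6).resolve_left (by norm_num)

/-- The trace of the tuple of bilinear forms against the first argument. -/
theorem Equivariant.sum_apply (hΘ : Equivariant α Θ) (A : GL (Fin n) ℂ) (l : Fin n → ℂ) :
    ∑ k, Θ (tens (Pi.single k 1) (l ᵥ* (A⁻¹).1) (Pi.single k 1)) =
      (∑ k, Θ (tens (Pi.single k 1) l (Pi.single k 1))) ᵥ* ((α A)⁻¹).1 := by
  -- The canonical element ∑ e_k ⊗ e_k* of V ⊗ V* is invariant under A.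
  have e : ∀ m : Fin n → ℂ, ∑ k, tens (Pi.single k 1) m (Pi.single k 1) =
      ∑ k, tens (A.1 *ᵥ Pi.single k 1) m (Pi.single k 1 ᵥ* (A⁻¹).1) := by
    intro m
    funext i
    ext a b
    simp only [tens, Finset.sum_apply, Matrix.sum_apply, Matrix.smul_apply,
      vecMulVec_apply, smul_eq_mul]
    have h1 : (A.1 * (A⁻¹).1) i b = (1 : Matrix (Fin n) (Fin n) ℂ) i b := by
      rw [← Units.val_mul, mul_inv_cancel, Units.val_one]
    simp only [mulVec_single_one, single_one_vecMul, col_apply, row_apply]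
    have h2 : ∑ k, A.1 i k * (m a * (A⁻¹).1 k b) = m a * (A.1 * (A⁻¹).1) i b := by
      rw [Matrix.mul_apply, Finset.mul_sum]
      exact Finset.sum_congr rfl fun k _ => by ring
    rw [h2, h1]
    simp [Pi.single_apply, Matrix.one_apply]
  rw [← map_sum, e, map_sum]
  have : ∀ k, Θ (tens (A.1 *ᵥ Pi.single k 1) (l ᵥ* (A⁻¹).1) (Pi.single k 1 ᵥ* (A⁻¹).1)) =
      Θ (tens (Pi.single k 1) l (Pi.single k 1)) ᵥ* ((α A)⁻¹).1 := fun k => hΘ A _ _ _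
  simp only [this]
  exact (map_sum (Matrix.vecMulLinear ((α A)⁻¹).1) _ _).symm

/-- A matrix which annihilates all translates of a nonzero vector under the linear group vanishes. -/
theorem eq_zero_of_forall_vecMul {P : Matrix (Fin n) (Fin n) ℂ} {l : Fin n → ℂ} (hl : l ≠ 0)
    (h : ∀ A : GL (Fin n) ℂ, (l ᵥ* A.1) ᵥ* P = 0) : P = 0 := by
  have h1 : l ᵥ* P = 0 := by simpa using h 1
  have key : ∀ m : Fin n → ℂ, m ᵥ* P = 0 := by
    intro m
    obtain ⟨u, hu, hu'⟩ := exists_dotProduct_ne_zero (v' := m) hl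
    rw [dotProduct_comm] at hu hu'
    have := h (rankOneGL u m hu')
    rw [rankOneGL.vecMul, add_vecMul, h1, zero_add, smul_vecMul] at this
    exact (smul_eq_zero.1 this).resolve_left hu
  ext i j
  simpa using congrFun (key (Pi.single i 1)) j

/-- The elements v ⊗ l² with l v = 0 span the trace-free symmetric part, and the hypothesis `h`
disposes of the complementary trace part. -/
theorem Equivariant.eq_zero (hΘ : Equivariant α Θ)
    (hsymm : ∀ v l m, Θ (tens v l m) = Θ (tens v m l))
    (h : ∀ l, ∑ k, Θ (tens (Pi.single k 1) l (Pi.single k 1)) = 0) : Θ = 0 := by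
  let e : Fin n → Fin n → ℂ := fun i => Pi.single i 1
  have polar : ∀ v l m, l ⬝ᵥ v = 0 → m ⬝ᵥ v = 0 → Θ (tens v l m) = 0 := by
    intro v l m hl hm
    have h1 := hΘ.apply_tens_eq_zero (v := v) (l := l + m) (by rw [add_dotProduct, hl, hm, add_zero])
    rw [tens_add_middle, tens_add_right, tens_add_right, map_add, map_add, map_add,
      hΘ.apply_tens_eq_zero hl, hΘ.apply_tens_eq_zero hm, hsymm v m l, zero_add, add_zero,
      ← two_smul ℂ] at h1
    exact (smul_eq_zero.1 h1).resolve_left two_ne_zero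
  have hee : ∀ {i j}, i ≠ j → e i ⬝ᵥ e j = 0 := by
    intro i j hij
    simp [e, hij]
  have hei : ∀ i, e i ⬝ᵥ e i = 1 := by
    intro i
    simp [e]
  -- Add the vanishing on (e_i − e_k) ⊗ (e_i + e_k)² and on (e_i + e_k) ⊗ (e_i − e_k)².
  have mixed : ∀ i k, i ≠ k → (2 : ℂ) • Θ (tens (e k) (e i) (e k)) = Θ (tens (e i) (e i) (e i)) := by
    intro i k hik
    have h1 := hΘ.apply_tens_eq_zero (v := e i + (-1 : ℂ) • e k) (l := e i + e k) (by
      simp [hee hik, hee hik.symm, hei])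
    have h2 := hΘ.apply_tens_eq_zero (v := e i + e k) (l := e i + (-1 : ℂ) • e k) (by
      simp [hee hik, hee hik.symm, hei])
    simp only [tens_add_left, tens_add_middle, tens_add_right,
      tens_smul_left, tens_smul_middle, tens_smul_right, map_add, map_smul] at h1 h2
    rw [hsymm (e i) (e k) (e i), hsymm (e k) (e k) (e i),
      polar (e i) (e k) (e k) (hee hik.symm) (hee hik.symm),
      polar (e k) (e i) (e i) (hee hik) (hee hik)] at h1 h2
    have h3 : (2 : ℂ) • ((2 : ℂ) • Θ (tens (e k) (e i) (e k)) - Θ (tens (e i) (e i) (e i))) =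
        (0 : ℂ) • (0 : Fin n → ℂ) + (-1 : ℂ) • ((0 : Fin n → ℂ) + 0) := by
      nth_rw 2 [← h1]
      rw [← h2]
      module
    rw [zero_smul, add_zero, smul_zero, add_zero] at h3
    exact sub_eq_zero.1 ((smul_eq_zero.1 h3).resolve_left two_ne_zero)
  -- By `mixed`, twice the trace relation is (n + 1) Θ(e_i ⊗ e_i²) = 0: the term k = i counts twice.
  have diag : ∀ i, Θ (tens (e i) (e i) (e i)) = 0 := by
    intro i
    have h1 := h (e i)
    have h2 : ∀ k, (2 : ℂ) • Θ (tens (e k) (e i) (e k)) =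
        (1 + if k = i then 1 else 0 : ℂ) • Θ (tens (e i) (e i) (e i)) := by
      intro k
      split_ifs with hk
      · rw [hk, one_add_one_eq_two]
      · rw [add_zero, one_smul]
        exact mixed i k (Ne.symm hk)
    have h3 : (2 : ℂ) • ∑ k, Θ (tens (e k) (e i) (e k)) = 0 := by
      rw [h1, smul_zero]
    rw [Finset.smul_sum, Finset.sum_congr rfl fun k _ => h2 k, ← Finset.sum_smul] at h3
    refine (smul_eq_zero.1 h3).resolve_left ?_
    rw [Finset.sum_add_distrib]
    simp only [Finset.sum_const, Finset.card_univ, Fintype.card_fin, Finset.sum_ite_eq',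
      Finset.mem_univ, if_true, nsmul_eq_mul, mul_one]
    exact_mod_cast Nat.succ_ne_zero n
  have off : ∀ i k, Θ (tens (e k) (e i) (e k)) = 0 := by
    intro i k
    by_cases hik : i = k
    · rw [hik, diag]
    · have := mixed i k hik
      rw [diag] at this
      exact (smul_eq_zero.1 this).resolve_left two_ne_zero
  have all : ∀ i j k, Θ (tens (e i) (e j) (e k)) = 0 := by
    intro i j k
    by_cases hk : k = i
    · rw [hk, off]
    · by_cases hj : j = i
      · rw [hj, hsymm, off]
      · exact polar _ _ _ (hee hj) (hee hk)
  refine LinearMap.ext fun w => ?_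
  rw [eq_sum_tens w]
  simp only [map_sum, map_smul, LinearMap.zero_apply, smul_zero, Finset.sum_const_zero]
  refine Finset.sum_eq_zero fun i _ => Finset.sum_eq_zero fun j _ => Finset.sum_eq_zero fun k _ => ?_
  change _ • Θ (tens (e i) (e j) (e k)) = 0
  rw [all i j k, smul_zero]

/-- An endomorphism `α` of the linear group which admits a nonzero equivariant symmetric map is
inner. -/
theorem Equivariant.exists_conj (hΘ : Equivariant α Θ) (h0 : Θ ≠ 0)
    (hsymm : ∀ v l m, Θ (tens v l m) = Θ (tens v m l)) :
    ∃ P : GL (Fin n) ℂ, ∀ A, P * α A * P⁻¹ = A := by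
  let f : (Fin n → ℂ) →ₗ[ℂ] (Fin n → ℂ) :=
    { toFun := fun l => ∑ k, Θ (tens (Pi.single k 1) l (Pi.single k 1))
      map_add' := fun a b => by simp only [tens_add_middle, map_add, Finset.sum_add_distrib]
      map_smul' := fun a b => by
        simp only [tens_smul_middle, map_smul, Finset.smul_sum, RingHom.id_apply] }
  let P : Matrix (Fin n) (Fin n) ℂ := (LinearMap.toMatrix' f)ᵀ
  have hP : ∀ l, l ᵥ* P = f l := by
    intro l
    rw [vecMul_transpose, LinearMap.toMatrix'_mulVec]
  have hf : ∀ (A : GL (Fin n) ℂ) l, (l ᵥ* (A⁻¹).1) ᵥ* P = (l ᵥ* P) ᵥ* ((α A)⁻¹).1 := by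
    intro A l
    rw [hP, hP]
    exact hΘ.sum_apply A l
  have hP0 : P ≠ 0 := by
    intro hz
    apply h0
    refine hΘ.eq_zero hsymm fun l => ?_
    change f l = 0
    rw [← hP, hz, vecMul_zero]
  -- The kernel of P is stable under the linear group by `hf`, so a nonzero kernel vector would
  -- force P = 0.
  have hu : IsUnit P := by
    rw [← Matrix.vecMul_injective_iff_isUnit]
    change Function.Injective (Matrix.vecMulLinear P)
    rw [injective_iff_map_eq_zero]
    intro l hl
    by_contra hne
    refine hP0 (eq_zero_of_forall_vecMul hne fun A => ?_)
    have := hf A⁻¹ l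
    rw [inv_inv] at this
    rw [this]
    rw [Matrix.vecMulLinear_apply] at hl
    rw [hl, zero_vecMul]
  obtain ⟨Q, hQ⟩ := hu
  refine ⟨Q, fun A => ?_⟩
  have hm : A⁻¹ * Q = Q * (α A)⁻¹ := by
    refine Units.ext ?_
    rw [Units.val_mul, Units.val_mul, hQ]
    ext i j
    have := congrFun (hf A (Pi.single i 1)) j
    rw [vecMul_vecMul, vecMul_vecMul] at this
    simpa using this
  rw [mul_inv_eq_iff_eq_mul]
  rw [inv_mul_eq_iff_eq_mul] at hm
  nth_rw 1 [hm]
  group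

end BilinTuple

/-! ### Congruences by degree and equations solved degree by degree -/

namespace FormalTuple

open MvPowerSeries

variable {n : ℕ}

/-- Congruence of tuples of power series modulo terms of degree at least `d`. -/
def Cong (d : ℕ) (f g : FormalTuple n) : Prop := ∀ i, f i - g i ∈ orderIdeal n d

theorem cong_iff {d : ℕ} {f g : FormalTuple n} :
    Cong d f g ↔ ∀ i (e : Fin n →₀ ℕ), e.degree < d → coeff e (f i) = coeff e (g i) := by
  refine forall_congr' fun i => ?_
  rw [mem_orderIdeal_iff_coeff]
  simp only [map_sub, sub_eq_zero]

theorem Cong.refl (d : ℕ) (f : FormalTuple n) : Cong d f f := cong_iff.2 fun _ _ _ => rfl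

theorem Cong.symm {d : ℕ} {f g : FormalTuple n} (h : Cong d f g) : Cong d g f :=
  cong_iff.2 fun i e he => (cong_iff.1 h i e he).symm

theorem Cong.trans {d : ℕ} {f g k : FormalTuple n} (h : Cong d f g) (h' : Cong d g k) :
    Cong d f k :=
  cong_iff.2 fun i e he => (cong_iff.1 h i e he).trans (cong_iff.1 h' i e he)

theorem Cong.mono {d d' : ℕ} (hd : d' ≤ d) {f g : FormalTuple n} (h : Cong d f g) : Cong d' f g :=
  cong_iff.2 fun i e he => cong_iff.1 h i e (lt_of_lt_of_le he hd)

theorem Cong.constantCoeff {d : ℕ} (hd : 1 ≤ d) {f g : FormalTuple n} (h : Cong d f g)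
    (hg : ∀ i, MvPowerSeries.constantCoeff (g i) = 0) (i : Fin n) :
    MvPowerSeries.constantCoeff (f i) = 0 := by
  rw [← hg i]
  simpa using cong_iff.1 h i 0 (by simpa using Nat.lt_of_succ_le hd)

theorem Cong.jacobian_eq {d : ℕ} (hd : 2 ≤ d) {f g : FormalTuple n} (h : Cong d f g) :
    jacobian f = jacobian g := by
  ext i j
  exact cong_iff.1 h i _ (by rw [Finsupp.degree_single]; omega)

/-- First-order expansion of composition in the second factor. -/
theorem coeff_comp_sub {d : ℕ} {c : ℂ} {f g g' : FormalTuple n} (hf : jacobian f = c • 1)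
    (hg : ∀ k, constantCoeff (g k) = 0) (hg' : ∀ k, constantCoeff (g' k) = 0)
    (h : Cong d g g') (i : Fin n) (e : Fin n →₀ ℕ) (he : e.degree ≤ d) :
    coeff e (comp f g i) - coeff e (comp f g' i) = c * (coeff e (g i) - coeff e (g' i)) := by
  rw [comp, comp, coeff_subst_sub hg hg' h (f i) e he]
  have : ∀ k, coeff (Finsupp.single k 1) (f i) = if i = k then c else 0 := by
    intro k
    change jacobian f i k = _
    rw [hf]
    simp [Matrix.one_apply]
  simp [this]

theorem Cong.comp_left {d : ℕ} (f : FormalTuple n) {g g' : FormalTuple n}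
    (hg : ∀ k, MvPowerSeries.constantCoeff (g k) = 0)
    (hg' : ∀ k, MvPowerSeries.constantCoeff (g' k) = 0)
    (h : Cong d g g') : Cong d (comp f g) (comp f g') := by
  rw [cong_iff]
  intro i e he
  rw [← sub_eq_zero]
  rw [comp, comp, coeff_subst_sub hg hg' h (f i) e he.le]
  refine Finset.sum_eq_zero fun k _ => ?_
  rw [cong_iff.1 h k e he, sub_self, mul_zero]

theorem prod_single_pow (h : FormalTuple n) (k : Fin n) (e : ℕ) :
    ((Finsupp.single k e).prod fun s e => h s ^ e) = h k ^ e :=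
  Finsupp.prod_single_index (h := fun s e => h s ^ e) (pow_zero _)

theorem exists_eq_single_add {d : ℕ} {e : Fin n →₀ ℕ} (he : e.degree = d + 1) :
    ∃ (j : Fin n) (e' : Fin n →₀ ℕ), e'.degree = d ∧ e = Finsupp.single j 1 + e' := by
  have hne : e ≠ 0 := by
    rintro rfl
    simp at he
  obtain ⟨j, hj⟩ := Finsupp.ne_iff.1 hne
  have hj : e j ≠ 0 := by simpa using hj
  have hle : Finsupp.single j 1 ≤ e := by
    rw [Finsupp.single_le_iff]
    omega
  have h1 := add_tsub_cancel_of_le hle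
  refine ⟨j, e - Finsupp.single j 1, ?_, h1.symm⟩
  have h2 := congrArg Finsupp.degree h1
  rw [map_add, Finsupp.degree_single] at h2
  omega

theorem monomial_mem_degree {h : FormalTuple n} (hh : ∀ k, constantCoeff (h k) = 0)
    (m : Fin n →₀ ℕ) : (m.prod fun s e => h s ^ e) ∈ orderIdeal n m.degree := by
  induction m using Finsupp.induction_linear with
  | zero => simp [mem_orderIdeal]
  | add a b ha hb =>
    rw [Finsupp.prod_add_index' (by simp) (fun _ _ _ => pow_add _ _ _), map_add]
    exact mul_mem_orderIdeal ha hb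
  | single k e =>
    rw [prod_single_pow, Finsupp.degree_single]
    induction e with
    | zero => simp [mem_orderIdeal]
    | succ e ih =>
      rw [pow_succ]
      exact mul_mem_orderIdeal ih (mem_orderIdeal_one.2 (hh k))

theorem monomial_sub_mem_degree {h h' : FormalTuple n} (hh : ∀ k, constantCoeff (h k) = 0)
    (hh' : ∀ k, constantCoeff (h' k) = 0) (hc : Cong 2 h h') (m : Fin n →₀ ℕ) :
    (m.prod fun s e => h s ^ e) - (m.prod fun s e => h' s ^ e) ∈ orderIdeal n (m.degree + 1) := by
  have e1 : ∀ a b a' b' : MvPowerSeries (Fin n) ℂ,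
      a * b - a' * b' = a * (b - b') + (a - a') * b' := by
    intros; ring
  induction m using Finsupp.induction_linear with
  | zero => simp
  | add a b ha hb =>
    rw [Finsupp.prod_add_index' (by simp) (fun _ _ _ => pow_add _ _ _),
      Finsupp.prod_add_index' (by simp) (fun _ _ _ => pow_add _ _ _), map_add, e1]
    refine add_mem ?_ ?_
    · rw [add_assoc]
      exact mul_mem_orderIdeal (monomial_mem_degree hh a) hb
    · rw [add_right_comm]
      exact mul_mem_orderIdeal ha (monomial_mem_degree hh' b)
  | single k e =>
    rw [prod_single_pow, prod_single_pow, Finsupp.degree_single]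
    induction e with
    | zero => simp
    | succ e ih =>
      rw [pow_succ, pow_succ, e1]
      refine add_mem ?_ (mul_mem_orderIdeal ih (mem_orderIdeal_one.2 (hh' k)))
      rw [add_assoc]
      refine mul_mem_orderIdeal ?_ (hc k)
      have := monomial_mem_degree hh (Finsupp.single k e)
      rwa [prod_single_pow, Finsupp.degree_single] at this

/-- Substituting `μ x` for `x`. -/
theorem coeff_subst_smul_X (μ : ℂ) (p : MvPowerSeries (Fin n) ℂ) (e : Fin n →₀ ℕ) :
    coeff e (subst (fun i => μ • X i : FormalTuple n) p) = μ ^ e.degree * coeff e p := by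
  have := rescale_eq_subst (fun _ : Fin n => μ) p
  have e2 : ((fun _ : Fin n => μ) • X : FormalTuple n) = fun i => μ • X i := rfl
  rw [← e2, ← this, coeff_rescale]
  simp only [Finsupp.prod, Finset.prod_pow_eq_pow_sum, Finsupp.degree_apply]

/-- The leading term of a substitution with scalar linear part. -/
theorem coeff_subst_of_mem {d : ℕ} {μ : ℂ} {h : FormalTuple n} (hh : ∀ k, constantCoeff (h k) = 0)
    (hj : jacobian h = μ • 1) {p : MvPowerSeries (Fin n) ℂ} (hp : p ∈ orderIdeal n d)
    (e : Fin n →₀ ℕ) (he : e.degree ≤ d) : coeff e (subst h p) = μ ^ e.degree * coeff e p := by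
  rw [← coeff_subst_smul_X]
  have hh' : ∀ k, constantCoeff ((fun i => μ • X i : FormalTuple n) k) = 0 := by
    intro k
    simp [constantCoeff_smul]
  have hc : Cong 2 h fun i => μ • X i := by
    rw [cong_iff]
    intro i e he
    rcases Nat.lt_succ_iff_lt_or_eq.1 he with h0 | h1
    · have : e = 0 := (Finsupp.degree_eq_zero_iff e).1 (by omega)
      subst this
      simpa using (hh i).trans (hh' i).symm
    · obtain ⟨j, e', he', rfl⟩ := exists_eq_single_add h1
      obtain rfl := (Finsupp.degree_eq_zero_iff e').1 he'
      rw [add_zero]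
      change jacobian h i j = _
      rw [hj]
      classical
      simp [coeff_X, Matrix.one_apply, Finsupp.single_left_inj, eq_comm]
  rw [coeff_subst (hasSubst_of_constantCoeff_zero hh),
    coeff_subst (hasSubst_of_constantCoeff_zero hh')]
  refine finsum_congr fun m => ?_
  -- Only the monomials m of p with degree at least d survive, and on these replacing h by its
  -- linear part changes only degrees above that of m.
  by_cases hm : m.degree < d
  · rw [mem_orderIdeal_iff_coeff.1 hp m hm, zero_smul, zero_smul]
  · congr 1
    rw [← sub_eq_zero, ← map_sub]
    exact mem_orderIdeal_iff_coeff.1 (monomial_sub_mem_degree hh hh' hc m) e (by omega)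

theorem subst_mem_orderIdeal {d : ℕ} {h : FormalTuple n} (hh : ∀ k, constantCoeff (h k) = 0)
    {p : MvPowerSeries (Fin n) ℂ} (hp : p ∈ orderIdeal n d) : subst h p ∈ orderIdeal n d := by
  rw [mem_orderIdeal_iff_coeff]
  intro e he
  rw [coeff_subst (hasSubst_of_constantCoeff_zero hh), finsum_eq_zero_of_forall_eq_zero]
  intro m
  by_cases hm : m.degree < d
  · rw [mem_orderIdeal_iff_coeff.1 hp m hm, zero_smul]
  · rw [mem_orderIdeal_iff_coeff.1 (monomial_mem_degree hh m) e (by omega), smul_zero]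

theorem Cong.comp_right {d : ℕ} {f f' : FormalTuple n} (h : Cong d f f') {g : FormalTuple n}
    (hg : ∀ k, MvPowerSeries.constantCoeff (g k) = 0) : Cong d (comp f g) (comp f' g) := by
  intro i
  rw [comp, comp, ← subst_sub (hasSubst_of_constantCoeff_zero hg)]
  exact subst_mem_orderIdeal hg (h i)

/-- First-order expansion of composition in the first factor. -/
theorem coeff_sub_comp {d : ℕ} {μ : ℂ} {f f' g : FormalTuple n} (hj : jacobian g = μ • 1)
    (hg : ∀ k, constantCoeff (g k) = 0) (h : Cong d f f') (i : Fin n) (e : Fin n →₀ ℕ)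
    (he : e.degree ≤ d) :
    coeff e (comp f g i) - coeff e (comp f' g i) =
      μ ^ d * (coeff e (f i) - coeff e (f' i)) := by
  rw [comp, comp, ← map_sub, ← subst_sub (hasSubst_of_constantCoeff_zero hg),
    coeff_subst_of_mem hg hj (h i) e he, map_sub]
  rcases he.lt_or_eq with he | he
  · rw [cong_iff.1 h i e he, sub_self, mul_zero, mul_zero]
  · rw [he]

/-- Solving an equation degree by degree. -/
theorem exists_eq_zero_of_triangular {a : ℕ} (Ψ : FormalTuple n → FormalTuple n) (c : ℕ → ℂ)
    (g₀ : FormalTuple n)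
    (hΨ : ∀ d, a ≤ d → ∀ g g' : FormalTuple n, Cong a g g₀ → Cong a g' g₀ → Cong d g g' →
      ∀ i (e : Fin n →₀ ℕ), e.degree ≤ d → coeff e (Ψ g i) - coeff e (Ψ g' i) =
        c d * (coeff e (g i) - coeff e (g' i)))
    (hc : ∀ d, a ≤ d → c d ≠ 0) (h₀ : Cong a (Ψ g₀) 0) :
    ∃ g, Cong a g g₀ ∧ Ψ g = 0 := by
  -- The k-th approximation solves the equation below degree a + k. An increment of degree d changes
  -- Ψ in degree d by the factor c d, so dividing the residue by c (a + k) corrects degree a + k.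
  let u : ℕ → FormalTuple n := fun k => Nat.rec g₀ (fun k v i e => coeff e (v i) -
    if e.degree = a + k then (c (a + k))⁻¹ * coeff e (Ψ v i) else 0) k
  have hu : ∀ k i e, coeff e (u (k + 1) i) = coeff e (u k i) -
    if e.degree = a + k then (c (a + k))⁻¹ * coeff e (Ψ (u k) i) else 0 := fun _ _ _ => rfl
  have hstep : ∀ k, Cong (a + k) (u (k + 1)) (u k) := by
    intro k
    rw [cong_iff]
    intro i e he
    rw [hu, if_neg (by omega), sub_zero]
  have hle : ∀ j k, j ≤ k → Cong (a + j) (u k) (u j) := by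
    intro j k hjk
    induction k, hjk using Nat.le_induction with
    | base => exact Cong.refl _ _
    | succ k hk ih => exact ((hstep k).mono (by omega)).trans ih
  have hu₀ : ∀ k, Cong a (u k) g₀ := fun k => hle 0 k (Nat.zero_le k)
  have hz : ∀ k, Cong (a + k) (Ψ (u k)) 0 := by
    intro k
    induction k with
    | zero => exact h₀
    | succ k ih =>
      rw [cong_iff]
      intro i e he
      have h1 := hΨ (a + k) (by omega) _ _ (hu₀ (k + 1)) (hu₀ k) (hstep k) i e (by omega)
      rw [hu, sub_sub_cancel_left, sub_eq_iff_eq_add] at h1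
      rw [h1]
      split_ifs with h2
      · rw [mul_neg, mul_inv_cancel_left₀ (hc _ (by omega))]
        simp
      · simpa using cong_iff.1 ih i e (by omega)
  -- Coefficients of degree d no longer change from u (d + 1) on.
  let g : FormalTuple n := fun i e => coeff e (u (e.degree + 1) i)
  have hg : ∀ k, Cong (a + k) g (u k) := by
    intro k
    rw [cong_iff]
    intro i e he
    change coeff e (u (e.degree + 1) i) = _
    rcases le_total (e.degree + 1) k with h | h
    · exact (cong_iff.1 (hle _ _ h) i e (by omega)).symm
    · exact cong_iff.1 (hle _ _ h) i e he
  refine ⟨g, hg 0, ?_⟩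
  funext i
  ext e
  have h1 := hΨ (a + (e.degree + 1)) (by omega) _ _ (hg 0) (hu₀ (e.degree + 1)) (hg _) i e (by omega)
  rw [cong_iff.1 (hg (e.degree + 1)) i e (by omega), sub_self, mul_zero, sub_eq_zero] at h1
  rw [h1]
  exact cong_iff.1 (hz (e.degree + 1)) i e (by omega)

end FormalTuple

/-! ### Filtration of the group and conjugacy equations -/

noncomputable section

namespace FormalDiffeo

open MvPowerSeries FormalTuple

variable {n : ℕ}

/-- The linear part of a formal diffeomorphism, as a homomorphism. -/
def jacHom (n : ℕ) : FormalDiffeo n →* Matrix.GeneralLinearGroup (Fin n) ℂ :=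
  MonoidHom.mk' (fun f => Matrix.GeneralLinearGroup.mk'' (jacobian f.toTuple) f.isUnit_det_jacobian)
    fun f g => Units.ext (jacobian_comp f.toTuple g.constantCoeff_eq_zero)

theorem val_jacHom (f : FormalDiffeo n) : (jacHom n f).1 = jacobian f.toTuple := rfl

theorem toTuple_linear (A : Matrix.GeneralLinearGroup (Fin n) ℂ) (i : Fin n) :
    (linear n A).toTuple i = ∑ j, A.1 i j • X j := rfl

theorem jacHom_linear (A : Matrix.GeneralLinearGroup (Fin n) ℂ) : jacHom n (linear n A) = A := by
  refine Units.ext ?_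
  rw [val_jacHom]
  ext i j
  classical
  simp [jacobian, toTuple_linear, coeff_X, Finsupp.single_left_inj]

/-- The homothety `x ↦ u x`. -/
def homothety (n : ℕ) (u : ℂˣ) : FormalDiffeo n :=
  linear n (Matrix.GeneralLinearGroup.scalar (Fin n) u)

theorem toTuple_homothety (u : ℂˣ) : (homothety n u).toTuple = fun i => (u : ℂ) • X i := by
  funext i
  classical
  rw [homothety, toTuple_linear]
  simp [Matrix.diagonal_apply]

theorem jacobian_homothety (u : ℂˣ) : jacobian (homothety n u).toTuple = (u : ℂ) • 1 := by
  rw [← val_jacHom, homothety, jacHom_linear]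
  simp [Matrix.smul_one_eq_diagonal]

theorem coeff_homothety_mul (u : ℂˣ) (f : FormalDiffeo n) (i : Fin n) (e : Fin n →₀ ℕ) :
    coeff e ((homothety n u * f).toTuple i) = u * coeff e (f.toTuple i) := by
  have hs := hasSubst_of_constantCoeff_zero f.constantCoeff_eq_zero
  rw [toTuple_mul, comp, toTuple_homothety, subst_smul hs, subst_X hs]
  simp

theorem coeff_mul_homothety (u : ℂˣ) (f : FormalDiffeo n) (i : Fin n) (e : Fin n →₀ ℕ) :
    coeff e ((f * homothety n u).toTuple i) = u ^ e.degree * coeff e (f.toTuple i) := by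
  rw [toTuple_mul, comp, toTuple_homothety, coeff_subst_smul_X]

/-- The formal diffeomorphisms which agree with the identity up to terms of degree at least `a`. -/
def congSubgroup (n a : ℕ) : Subgroup (FormalDiffeo n) where
  carrier := {f | Cong a f.toTuple (1 : FormalDiffeo n).toTuple}
  one_mem' := Cong.refl _ _
  mul_mem' {f g} hf hg := by
    have := Cong.comp_right hf g.constantCoeff_eq_zero
    rw [← toTuple_mul, ← toTuple_mul, one_mul] at this
    exact this.trans hg
  inv_mem' {f} hf := by
    have := Cong.comp_right hf (f⁻¹).constantCoeff_eq_zero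
    rw [← toTuple_mul, ← toTuple_mul, one_mul, mul_inv_cancel] at this
    exact this.symm

theorem mem_congSubgroup {a : ℕ} {f : FormalDiffeo n} :
    f ∈ congSubgroup n a ↔ Cong a f.toTuple (1 : FormalDiffeo n).toTuple := Iff.rfl

instance (a : ℕ) : (congSubgroup n a).Normal where
  conj_mem f hf g := by
    have h1 := Cong.comp_right hf (g⁻¹).constantCoeff_eq_zero
    have h2 := Cong.comp_left g.toTuple (f * g⁻¹).constantCoeff_eq_zero
      (1 * g⁻¹).constantCoeff_eq_zero h1
    rw [← toTuple_mul, ← toTuple_mul, one_mul, mul_inv_cancel, ← mul_assoc] at h2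
    exact h2

theorem mem_congSubgroup_two {f : FormalDiffeo n} : f ∈ congSubgroup n 2 ↔ jacHom n f = 1 := by
  constructor
  · intro h
    refine Units.ext ?_
    rw [val_jacHom, Cong.jacobian_eq le_rfl h, ← val_jacHom, map_one]
  · intro h
    rw [mem_congSubgroup, cong_iff]
    intro i e he
    rcases Nat.lt_succ_iff_lt_or_eq.1 he with h0 | h1
    · obtain rfl := (Finsupp.degree_eq_zero_iff e).1 (by omega)
      simpa using (f.constantCoeff_eq_zero i).trans ((1 : FormalDiffeo n).constantCoeff_eq_zero i).symm
    · obtain ⟨j, e', he', rfl⟩ := exists_eq_single_add h1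
      obtain rfl := (Finsupp.degree_eq_zero_iff e').1 he'
      rw [add_zero]
      change (jacHom n f).1 i j = (jacHom n 1).1 i j
      rw [h, map_one]

theorem jacobian_of_mem {f : FormalDiffeo n} (hf : f ∈ congSubgroup n 2) :
    jacobian f.toTuple = 1 := by
  rw [← val_jacHom, mem_congSubgroup_two.1 hf, Units.val_one]

theorem congSubgroup_mono {a b : ℕ} (h : a ≤ b) : congSubgroup n b ≤ congSubgroup n a :=
  fun _ hf => Cong.mono h hf

/-- A tuple which agrees with the identity up to terms of degree at least two. -/
def ofCong (g : FormalTuple n) (hg : Cong 2 g (1 : FormalDiffeo n).toTuple) : FormalDiffeo n where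
  toTuple := g
  constantCoeff_eq_zero :=
    hg.constantCoeff one_le_two (1 : FormalDiffeo n).constantCoeff_eq_zero
  isUnit_det_jacobian := by
    rw [hg.jacobian_eq le_rfl]
    exact (1 : FormalDiffeo n).isUnit_det_jacobian

/-- To first order composition is addition of the deviations from the identity, and this includes
degree a itself. Hence quadratic parts add when a = 2. -/
theorem coeff_mul_of_mem {a : ℕ} (ha : 2 ≤ a) {f g : FormalDiffeo n} (hf : f ∈ congSubgroup n a)
    (hg : g ∈ congSubgroup n a) (i : Fin n) (e : Fin n →₀ ℕ) (he : e.degree ≤ a) :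
    coeff e ((f * g).toTuple i) = coeff e (f.toTuple i) + coeff e (g.toTuple i) -
      coeff e ((1 : FormalDiffeo n).toTuple i) := by
  have := coeff_comp_sub (c := 1) (f := f.toTuple)
    (by rw [jacobian_of_mem (congSubgroup_mono ha hf), one_smul]) g.constantCoeff_eq_zero
    (1 : FormalDiffeo n).constantCoeff_eq_zero hg i e he
  rw [← toTuple_mul, ← toTuple_mul, mul_one] at this
  linear_combination this

/-- Here p stands for g ↦ g or g ↦ g ∘ g, and m for its derivative at the identity. A degree-d
change of g alters the left side by the factor μ m and the right side by μ ^ d; `hμ` says that the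
difference never vanishes. -/
theorem exists_solution {a : ℕ} (ha : 2 ≤ a) {h f : FormalDiffeo n} {μ m : ℂ}
    (hh : jacobian h.toTuple = μ • 1) (hf : f ∈ congSubgroup n a) (p : FormalTuple n → FormalTuple n)
    (hp₁ : Cong a (p (1 : FormalDiffeo n).toTuple) (1 : FormalDiffeo n).toTuple)
    (hp₀ : ∀ g, Cong a g (1 : FormalDiffeo n).toTuple → ∀ i, constantCoeff (p g i) = 0)
    (hp : ∀ d, a ≤ d → ∀ g g' : FormalTuple n, Cong a g (1 : FormalDiffeo n).toTuple →
      Cong a g' (1 : FormalDiffeo n).toTuple → Cong d g g' → ∀ i (e : Fin n →₀ ℕ), e.degree ≤ d →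
        coeff e (p g i) - coeff e (p g' i) = m * (coeff e (g i) - coeff e (g' i)))
    (hμ : ∀ d, a ≤ d → μ ^ d ≠ μ * m) :
    ∃ g : FormalDiffeo n, g ∈ congSubgroup n a ∧
      comp h.toTuple (comp f.toTuple (p g.toTuple)) = comp g.toTuple h.toTuple := by
  have h1 : ∀ i, constantCoeff ((1 : FormalDiffeo n).toTuple i) = 0 :=
    (1 : FormalDiffeo n).constantCoeff_eq_zero
  obtain ⟨g, hg, hg0⟩ := exists_eq_zero_of_triangular (a := a)
    (fun g => comp h.toTuple (comp f.toTuple (p g)) - comp g h.toTuple)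
    (fun d => μ * m - μ ^ d) (1 : FormalDiffeo n).toTuple (by
      intro d hd g g' hg hg' hc i e he
      have hpc : Cong d (p g) (p g') := by
        rw [cong_iff]
        intro i e he
        have := hp d hd g g' hg hg' hc i e he.le
        rwa [cong_iff.1 hc i e he, sub_self, mul_zero, sub_eq_zero] at this
      have hfc := Cong.comp_left f.toTuple (hp₀ g hg) (hp₀ g' hg') hpc
      have e1 := coeff_comp_sub hh (constantCoeff_comp f.constantCoeff_eq_zero (hp₀ g hg))
        (constantCoeff_comp f.constantCoeff_eq_zero (hp₀ g' hg')) hfc i e he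
      have e2 := coeff_comp_sub (c := 1)
        (by rw [jacobian_of_mem (congSubgroup_mono ha hf), one_smul]) (hp₀ g hg) (hp₀ g' hg') hpc
        i e he
      have e3 := hp d hd g g' hg hg' hc i e he
      have e4 := coeff_sub_comp hh h.constantCoeff_eq_zero hc i e he
      simp only [Pi.sub_apply, map_sub]
      linear_combination e1 + μ * e2 + μ * e3 - e4)
    (fun d hd => sub_ne_zero.2 (hμ d hd).symm) (by
      have hfp : Cong a (comp f.toTuple (p (1 : FormalDiffeo n).toTuple))
          (1 : FormalDiffeo n).toTuple := by
        have := Cong.comp_left f.toTuple (hp₀ _ (Cong.refl _ _)) h1 hp₁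
        rw [← toTuple_mul, mul_one] at this
        exact this.trans hf
      have := Cong.comp_left h.toTuple (constantCoeff_comp f.constantCoeff_eq_zero
        (hp₀ _ (Cong.refl _ _))) h1 hfp
      rw [← toTuple_mul, mul_one] at this
      intro i
      rw [← toTuple_mul 1 h, one_mul]
      simpa using this i)
  exact ⟨ofCong g (hg.mono ha), hg, sub_eq_zero.1 hg0⟩

theorem exists_mul_eq {a : ℕ} (ha : 2 ≤ a) {h f : FormalDiffeo n} {μ : ℂ}
    (hh : jacobian h.toTuple = μ • 1) (hf : f ∈ congSubgroup n a)
    (hμ : ∀ d, a ≤ d → μ ^ d ≠ μ) : ∃ g ∈ congSubgroup n a, h * f * g = g * h := by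
  obtain ⟨g, hg, hg'⟩ := exists_solution ha hh hf (m := 1) id (Cong.refl _ _)
    (fun g hg => hg.constantCoeff (by omega) (1 : FormalDiffeo n).constantCoeff_eq_zero)
    (fun d _ g g' _ _ _ i e _ => by rw [one_mul]; rfl) (fun d hd => by rw [mul_one]; exact hμ d hd)
  refine ⟨g, hg, ?_⟩
  rw [mul_assoc]
  exact FormalDiffeo.ext hg'

/-- Squaring doubles first-order deviations, so m = 2. The shifted resonance condition is what later
distinguishes the ratio 2. -/
theorem exists_mul_sq_eq {a : ℕ} (ha : 2 ≤ a) {h f : FormalDiffeo n} {μ : ℂ}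
    (hh : jacobian h.toTuple = μ • 1) (hf : f ∈ congSubgroup n a)
    (hμ : ∀ d, a ≤ d → μ ^ d ≠ μ * 2) : ∃ g ∈ congSubgroup n a, h * f * (g * g) = g * h := by
  have hc : ∀ g : FormalTuple n, Cong a g (1 : FormalDiffeo n).toTuple →
      ∀ i, constantCoeff (g i) = 0 :=
    fun g hg => hg.constantCoeff (by omega) (1 : FormalDiffeo n).constantCoeff_eq_zero
  have hj : ∀ g : FormalTuple n, Cong a g (1 : FormalDiffeo n).toTuple →
      jacobian g = (1 : ℂ) • 1 := by
    intro g hg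
    rw [hg.jacobian_eq ha, one_smul]
    exact jacobian_of_mem (one_mem _)
  obtain ⟨g, hg, hg'⟩ := exists_solution ha hh hf (m := 2) (fun g => comp g g)
    (by rw [← toTuple_mul, mul_one]; exact Cong.refl _ _)
    (fun g hg => constantCoeff_comp (hc g hg) (hc g hg))
    (fun d hd g g' hg hg' hcong i e he => by
      have e1 := coeff_comp_sub (hj g hg) (hc g hg) (hc g' hg') hcong i e he
      have e2 := coeff_sub_comp (hj g' hg') (hc g' hg') hcong i e he
      rw [one_pow] at e2
      linear_combination e1 + e2) hμ
  refine ⟨g, hg, ?_⟩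
  rw [mul_assoc]
  exact FormalDiffeo.ext hg'

/-- A formal diffeomorphism whose linear part is a nonresonant homothety is linearizable. -/
theorem exists_conj_eq_homothety {h : FormalDiffeo n} {u : ℂˣ}
    (hh : jacobian h.toTuple = (u : ℂ) • 1) (hu : ∀ d, 2 ≤ d → (u : ℂ) ^ d ≠ u) :
    ∃ g : FormalDiffeo n, g * h * g⁻¹ = homothety n u := by
  have hf : h⁻¹ * homothety n u ∈ congSubgroup n 2 := by
    rw [mem_congSubgroup_two, map_mul, map_inv, inv_mul_eq_one]
    refine Units.ext ?_
    rw [val_jacHom, val_jacHom, hh, jacobian_homothety]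
  obtain ⟨g, -, hg⟩ := exists_mul_eq le_rfl hh hf hu
  refine ⟨g, ?_⟩
  rw [← hg]
  group

end FormalDiffeo

end

/-! ### Quadratic parts and the linear action on them -/

noncomputable section

namespace BilinTuple

open Matrix

variable {n : ℕ}

/-- The action of the linear group on quadratic vector fields. -/
def act (A : GL (Fin n) ℂ) (w : BilinTuple n) : BilinTuple n :=
  fun i => ∑ l, A.1 i l • ((A⁻¹).1ᵀ * w l * (A⁻¹).1)

theorem act_tens (A : GL (Fin n) ℂ) (v l m : Fin n → ℂ) :
    act A (tens v l m) = tens (A.1 *ᵥ v) (l ᵥ* (A⁻¹).1) (m ᵥ* (A⁻¹).1) := by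
  funext i
  simp only [act, tens, Matrix.mul_smul, Matrix.smul_mul, smul_smul, ← Finset.sum_smul]
  rw [mul_vecMulVec, vecMulVec_mul, mulVec_transpose]
  rfl

/-- The value contributes u and each of the two arguments u⁻¹. Through this, homotheties encode
scalar multiplication. -/
theorem act_scalar (u : ℂˣ) (w : BilinTuple n) :
    act (GeneralLinearGroup.scalar (Fin n) u) w = (u⁻¹ : ℂˣ).1 • w := by
  funext i
  rw [act, ← map_inv]
  simp only [GeneralLinearGroup.coe_scalar, scalar_apply, diagonal_transpose, Pi.smul_apply]
  rw [Finset.sum_eq_single i]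
  · rw [← smul_one_eq_diagonal, ← smul_one_eq_diagonal]
    simp [smul_smul]
  · intro l _ hl
    rw [diagonal_apply_ne _ hl.symm, zero_smul]
  · simp

/-- The divergence of a quadratic vector field. -/
def div (n : ℕ) : BilinTuple n →ₗ[ℂ] (Fin n → ℂ) where
  toFun w k := ∑ i, w i i k
  map_add' w w' := by
    funext k
    simp [Finset.sum_add_distrib]
  map_smul' a w := by
    funext k
    simp [Finset.mul_sum]

theorem div_apply (w : BilinTuple n) (k : Fin n) : div n w k = ∑ i, w i i k := rfl

theorem div_act (A : GL (Fin n) ℂ) (w : BilinTuple n) :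
    div n (act A w) = div n w ᵥ* (A⁻¹).1 := by
  funext k
  simp only [div_apply, act, vecMul, dotProduct, Matrix.sum_apply, Matrix.smul_apply, smul_eq_mul]
  rw [Finset.sum_comm]
  have h : ∀ l, ∑ i, A.1 i l * ((A⁻¹).1ᵀ * w l * (A⁻¹).1) i k = ∑ j, w l l j * (A⁻¹).1 j k := by
    intro l
    have : ∑ i, A.1 i l * ((A⁻¹).1ᵀ * w l * (A⁻¹).1) i k =
        (A.1ᵀ * ((A⁻¹).1ᵀ * w l * (A⁻¹).1)) l k := by
      rw [Matrix.mul_apply]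
      rfl
    rw [this, ← Matrix.mul_assoc, ← Matrix.mul_assoc, ← transpose_mul, ← Units.val_mul,
      inv_mul_cancel, Units.val_one, transpose_one, Matrix.one_mul, Matrix.mul_apply]
  simp only [h]
  rw [Finset.sum_comm]
  simp only [Finset.sum_mul]

end BilinTuple

namespace FormalDiffeo

open MvPowerSeries FormalTuple BilinTuple

variable {n : ℕ}

/-- The quadratic form with a given matrix, as a power series. -/
def quadSeries (n : ℕ) : Matrix (Fin n) (Fin n) ℂ →ₗ[ℂ] MvPowerSeries (Fin n) ℂ where
  toFun M := ∑ j, ∑ k, M j k • (X j * X k)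
  map_add' M N := by simp [add_smul, Finset.sum_add_distrib]
  map_smul' a M := by simp [mul_smul, Finset.smul_sum]

theorem quadSeries_apply (M : Matrix (Fin n) (Fin n) ℂ) :
    quadSeries n M = ∑ j, ∑ k, M j k • (X j * X k) := rfl

theorem quadSeries_mem (M : Matrix (Fin n) (Fin n) ℂ) : quadSeries n M ∈ orderIdeal n 2 := by
  rw [quadSeries_apply]
  refine Ideal.sum_mem _ fun j _ => Ideal.sum_mem _ fun k _ => ?_
  rw [smul_eq_C_mul]
  refine Ideal.mul_mem_left _ _ (mul_mem_orderIdeal (a := 1) (b := 1) ?_ ?_) <;>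
  simp [mem_orderIdeal_one]

theorem subst_quadSeries (A : Matrix.GeneralLinearGroup (Fin n) ℂ)
    (M : Matrix (Fin n) (Fin n) ℂ) :
    subst (linear n A).toTuple (quadSeries n M) = quadSeries n (A.1.transpose * M * A.1) := by
  have hs := hasSubst_of_constantCoeff_zero (linear n A).constantCoeff_eq_zero
  have sw : ∀ f : Fin n → Fin n → Fin n → Fin n → MvPowerSeries (Fin n) ℂ,
      ∑ a, ∑ b, ∑ k, ∑ j, f a b k j = ∑ j, ∑ k, ∑ a, ∑ b, f a b k j := by
    intro f
    rw [Finset.sum_congr rfl fun a _ => Finset.sum_comm, Finset.sum_comm]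
    rw [Finset.sum_comm (f := fun j k => ∑ a, ∑ b, f a b k j)]
    refine Finset.sum_congr rfl fun k _ => ?_
    rw [Finset.sum_congr rfl fun a _ => Finset.sum_comm, Finset.sum_comm]
  rw [quadSeries_apply, quadSeries_apply, ← substAlgHom_apply hs]
  simp only [map_sum, map_smul, map_mul, substAlgHom_X, toTuple_linear,
    Matrix.mul_apply, Matrix.transpose_apply, Finset.sum_mul, Finset.sum_smul]
  rw [sw]
  refine Finset.sum_congr rfl fun j _ => Finset.sum_congr rfl fun k _ => ?_
  rw [Finset.smul_sum]
  refine Finset.sum_congr rfl fun a _ => ?_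
  rw [Finset.mul_sum, Finset.smul_sum]
  refine Finset.sum_congr rfl fun b _ => ?_
  rw [smul_mul_smul_comm, smul_smul]
  congr 1
  ring

/-- The formal diffeomorphism `x ↦ x + w(x, x)`. -/
def ofQuad (w : BilinTuple n) : FormalDiffeo n :=
  ofCong (fun i => X i + quadSeries n (w i)) fun i => by
    change X i + quadSeries n (w i) - X i ∈ _
    rw [add_sub_cancel_left]
    exact quadSeries_mem _

theorem toTuple_ofQuad (w : BilinTuple n) (i : Fin n) :
    (ofQuad w).toTuple i = X i + quadSeries n (w i) := rfl

theorem ofQuad_mem (w : BilinTuple n) : ofQuad w ∈ congSubgroup n 2 := fun i => by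
  change X i + quadSeries n (w i) - X i ∈ _
  rw [add_sub_cancel_left]
  exact quadSeries_mem _

theorem linear_conj_ofQuad (A : Matrix.GeneralLinearGroup (Fin n) ℂ) (w : BilinTuple n) :
    linear n A * ofQuad w * (linear n A)⁻¹ = ofQuad (act A w) := by
  rw [mul_inv_eq_iff_eq_mul]
  refine FormalDiffeo.ext (funext fun i => ?_)
  have hw := hasSubst_of_constantCoeff_zero (ofQuad w).constantCoeff_eq_zero
  have hA := hasSubst_of_constantCoeff_zero (linear n A).constantCoeff_eq_zero
  rw [toTuple_mul, toTuple_mul, comp, comp, toTuple_ofQuad, subst_add hA, subst_X hA,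
    subst_quadSeries, act, toTuple_linear, ← substAlgHom_apply hw, map_sum]
  simp only [map_smul, substAlgHom_X, toTuple_ofQuad, smul_add, Finset.sum_add_distrib]
  congr 1
  rw [Finset.mul_sum, Finset.sum_mul, map_sum]
  refine Finset.sum_congr rfl fun l _ => ?_
  rw [Matrix.mul_smul, Matrix.smul_mul, map_smul]
  congr 2
  rw [← Matrix.mul_assoc, ← Matrix.mul_assoc, ← Matrix.transpose_mul, Matrix.mul_assoc,
    ← Units.val_mul, inv_mul_cancel, Units.val_one, Matrix.transpose_one, Matrix.one_mul,
    Matrix.mul_one]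

/-- The quadratic part of a formal diffeomorphism. -/
def hess (f : FormalDiffeo n) : BilinTuple n := fun i => Matrix.of fun j k =>
  (if j = k then 1 else 1 / 2) * coeff (Finsupp.single j 1 + Finsupp.single k 1) (f.toTuple i)

theorem hess_apply (f : FormalDiffeo n) (i j k : Fin n) : hess f i j k =
    (if j = k then 1 else 1 / 2) *
      coeff (Finsupp.single j 1 + Finsupp.single k 1) (f.toTuple i) := rfl

theorem hess_symm (f : FormalDiffeo n) (i j k : Fin n) : hess f i j k = hess f i k j := by
  rw [hess_apply, hess_apply, add_comm]
  simp only [eq_comm]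

theorem hess_one : hess (1 : FormalDiffeo n) = 0 := by
  funext i
  ext j k
  classical
  have h : coeff (Finsupp.single j 1 + Finsupp.single k 1)
      ((1 : FormalDiffeo n).toTuple i) = 0 := by
    rw [toTuple_one, coeff_X, if_neg]
    intro h
    simpa using congrArg Finsupp.degree h
  rw [hess_apply, h, mul_zero]
  rfl

theorem hess_mul {f g : FormalDiffeo n} (hf : f ∈ congSubgroup n 2) (hg : g ∈ congSubgroup n 2) :
    hess (f * g) = hess f + hess g := by
  funext i
  ext j k
  have h1 := congrFun (congrFun (congrFun (hess_one (n := n)) i) j) k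
  change _ = (0 : ℂ) at h1
  rw [Pi.add_apply, Matrix.add_apply]
  rw [hess_apply] at h1 ⊢
  rw [hess_apply, hess_apply, coeff_mul_of_mem le_rfl hf hg _ _ (by simp)]
  linear_combination -h1

theorem mem_congSubgroup_three {f : FormalDiffeo n} (hf : f ∈ congSubgroup n 2) :
    f ∈ congSubgroup n 3 ↔ hess f = 0 := by
  constructor
  · intro h
    rw [← hess_one]
    funext i
    ext j k
    rw [hess_apply, hess_apply, cong_iff.1 h i _ (by simp)]
  · intro h
    rw [mem_congSubgroup, cong_iff]
    intro i e he
    rcases Nat.lt_succ_iff_lt_or_eq.1 he with h0 | h1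
    · exact cong_iff.1 hf i e h0
    · obtain ⟨j, e', he', rfl⟩ := exists_eq_single_add h1
      obtain ⟨k, e'', he'', rfl⟩ := exists_eq_single_add he'
      obtain rfl := (Finsupp.degree_eq_zero_iff e'').1 he''
      rw [← hess_one] at h
      have := congrFun (congrFun (congrFun h i) j) k
      rw [hess_apply, hess_apply] at this
      rw [add_zero]
      refine mul_left_cancel₀ ?_ this
      split_ifs <;> norm_num

theorem hess_inv {f : FormalDiffeo n} (hf : f ∈ congSubgroup n 2) : hess f⁻¹ = -hess f := by
  rw [eq_neg_iff_add_eq_zero, ← hess_mul (inv_mem hf) hf, inv_mul_cancel, hess_one]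

theorem hess_eq_iff {f g : FormalDiffeo n} (hf : f ∈ congSubgroup n 2)
    (hg : g ∈ congSubgroup n 2) : hess f = hess g ↔ f * g⁻¹ ∈ congSubgroup n 3 := by
  rw [mem_congSubgroup_three (mul_mem hf (inv_mem hg)), hess_mul hf (inv_mem hg), hess_inv hg,
    ← sub_eq_add_neg, sub_eq_zero]

/-- For j ≠ k the monomial x_j x_k collects the entries (j, k) and (k, j), while x_j² collects one;
the factor 1/2 in `hess` compensates, leaving the symmetric part of w. -/
theorem hess_ofQuad (w : BilinTuple n) (i j k : Fin n) :
    hess (ofQuad w) i j k = (w i j k + w i k j) / 2 := by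
  classical
  have h1 := congrFun (congrFun (congrFun (hess_one (n := n)) i) j) k
  change _ = (0 : ℂ) at h1
  rw [hess_apply, toTuple_one] at h1
  rw [hess_apply, toTuple_ofQuad, map_add, mul_add, h1, zero_add, quadSeries_apply]
  have hc : ∀ a b : Fin n, coeff (Finsupp.single j 1 + Finsupp.single k 1)
      (X a * X b : MvPowerSeries (Fin n) ℂ) =
        if (j = a ∧ k = b) ∨ (j = b ∧ k = a) then 1 else 0 := by
    intro a b
    rw [X, X, monomial_mul_monomial, coeff_monomial, mul_one]
    congr 1
    rw [Finsupp.single_add_single_eq_single_add_single one_ne_zero one_ne_zero]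
    simp
  simp only [map_sum, map_smul, hc, smul_eq_mul]
  by_cases hjk : j = k
  · subst hjk
    have : ∀ a b : Fin n, ((j = a ∧ j = b) ∨ (j = b ∧ j = a)) ↔ (j = a ∧ j = b) := by tauto
    simp [this, ite_and]
  · have : ∀ a b : Fin n, (if (j = a ∧ k = b) ∨ (j = b ∧ k = a) then 1 else 0 : ℂ) =
        (if j = a then if k = b then 1 else 0 else 0) +
          if k = a then if j = b then 1 else 0 else 0 := by
      intro a b
      rw [← ite_and, ← ite_and]
      by_cases h1 : j = a ∧ k = b
      · have h2 : ¬(j = b ∧ k = a) := by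
          rintro ⟨rfl, rfl⟩
          exact hjk h1.1
        simp [h1.1, h1.2]
        grind
      · simp [h1, and_comm]
    simp only [this, mul_add, Finset.sum_add_distrib]
    simp [hjk]
    ring

theorem hess_ofQuad_hess (f : FormalDiffeo n) : hess (ofQuad (hess f)) = hess f := by
  funext i
  ext j k
  rw [hess_ofQuad, hess_symm f i k j]
  ring

/-- Modulo the normal subgroup `congSubgroup n 3`, f may be replaced by the purely quadratic `ofQuad
(hess f)`, for which the conjugate is explicit. -/
theorem hess_conj {f : FormalDiffeo n} (hf : f ∈ congSubgroup n 2)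
    (A : Matrix.GeneralLinearGroup (Fin n) ℂ) :
    hess (linear n A * f * (linear n A)⁻¹) = act A (hess f) := by
  have h1 : hess (linear n A * f * (linear n A)⁻¹) = hess (ofQuad (act A (hess f))) := by
    rw [← linear_conj_ofQuad, hess_eq_iff]
    · have := (inferInstance : (congSubgroup n 3).Normal).conj_mem _
        ((hess_eq_iff hf (ofQuad_mem _)).1 (hess_ofQuad_hess f).symm) (linear n A)
      convert this using 1
      group
    · exact (inferInstance : (congSubgroup n 2).Normal).conj_mem _ hf _
    · exact (inferInstance : (congSubgroup n 2).Normal).conj_mem _ (ofQuad_mem _) _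
  rw [h1]
  funext i
  ext j k
  rw [hess_ofQuad]
  have : act A (hess f) i k j = act A (hess f) i j k := by
    have ht : ∀ l, (hess f l).transpose = hess f l := by
      intro l
      ext a b
      exact hess_symm f l b a
    have : (act A (hess f) i).transpose = act A (hess f) i := by
      simp only [act, Matrix.transpose_sum, Matrix.transpose_smul, Matrix.transpose_mul,
        Matrix.transpose_transpose, ht, Matrix.mul_assoc]
    exact congrFun (congrFun this j) k
  rw [this]
  ring

end FormalDiffeo

end

/-! ### The image of the dilation -/

noncomputable section

namespace FormalDiffeo

open MvPowerSeries FormalTuple BilinTuple Matrix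

variable {n : ℕ}

/-- The homothety of ratio two. -/
abbrev dilation (n : ℕ) : FormalDiffeo n := homothety n (Units.mk0 2 two_ne_zero)

theorem two_pow_ne {d : ℕ} (hd : 2 ≤ d) : (2 : ℂ) ^ d ≠ 2 := by
  intro h
  have h1 : (2 : ℕ) ^ d = 2 ^ 1 := by exact_mod_cast h.trans (pow_one 2).symm
  have := Nat.pow_right_injective le_rfl h1
  omega

theorem two_pow_eq {d : ℕ} (h : (2 : ℂ) ^ d = 2) : d = 1 := by
  have h1 : (2 : ℕ) ^ d = 2 ^ 1 := by exact_mod_cast h.trans (pow_one 2).symm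
  exact Nat.pow_right_injective le_rfl h1

theorem linear_mul_homothety (u : ℂˣ) (A : GL (Fin n) ℂ) :
    linear n A * homothety n u = homothety n u * linear n A := by
  rw [homothety, ← map_mul, ← map_mul]
  congr 1
  refine Subgroup.mem_center_iff.1 ?_ A
  rw [GeneralLinearGroup.center_eq_range_scalar]
  exact ⟨u, rfl⟩

/-- The linear part of the image of the dilation is a homothety. -/
theorem jacHom_apply_dilation_mem_center (hn : 0 < n) (σ : MulAut (FormalDiffeo n)) :
    jacHom n (σ (dilation n)) ∈ Subgroup.center (GL (Fin n) ℂ) := by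
  set M := jacHom n (σ (dilation n)) with hM
  have key : ∀ f ∈ congSubgroup n 2, ∃ B : GL (Fin n) ℂ,
      M * jacHom n (σ f) = B * M * B⁻¹ := by
    intro f hf
    obtain ⟨g, -, hg⟩ := exists_mul_eq le_rfl (jacobian_homothety _) hf
      (fun d hd => by simpa using two_pow_ne hd) (h := dilation n)
    refine ⟨jacHom n (σ g), ?_⟩
    rw [eq_mul_inv_iff_mul_eq, hM, ← map_mul, ← map_mul, ← map_mul, ← map_mul, ← map_mul, ← map_mul,
      hg]
  by_contra hcon
  -- As `congSubgroup n 2` is normal and σ surjective, `key` applies to every linear conjugate of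
  -- the linear part of σ f, which is the hypothesis of the trace criterion.
  have hq : ∀ f ∈ congSubgroup n 2, jacHom n (σ f) ∈ Subgroup.center (GL (Fin n) ℂ) := by
    intro f hf
    refine (mem_center_or_mem_center_of_trace (M := M) fun A => ?_).resolve_left hcon
    obtain ⟨a, ha⟩ := σ.surjective (linear n A)
    obtain ⟨B, hB⟩ := key (a * f * a⁻¹)
      ((inferInstance : (congSubgroup n 2).Normal).conj_mem f hf a)
    rw [map_mul, map_mul, map_mul, map_mul, map_inv, map_inv, ha, jacHom_linear] at hB
    rw [hB, Units.val_mul, trace_mul_comm, ← Units.val_mul, inv_mul_cancel_left]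
  apply hcon
  rw [GeneralLinearGroup.mem_center_iff_val_mem_range_scalar]
  refine mem_range_scalar_of_commute_transvectionStruct fun t => ?_
  let B : GL (Fin n) ℂ := ⟨t.toMatrix, t.inv.toMatrix, t.mul_inv, t.inv_mul⟩
  obtain ⟨b, hb⟩ := σ.surjective (linear n B)
  -- The dilation has central linear part, so its commutators are tangent to the identity. By `hq`,
  -- M then commutes with B up to a scalar.
  have hf : (dilation n)⁻¹ * b * dilation n * b⁻¹ ∈ congSubgroup n 2 := by
    rw [mem_congSubgroup_two, map_mul, map_mul, map_mul, map_inv, map_inv, dilation, homothety,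
      jacHom_linear, mul_inv_eq_one, mul_assoc, inv_mul_eq_iff_eq_mul]
    refine Subgroup.mem_center_iff.1 ?_ _
    rw [GeneralLinearGroup.center_eq_range_scalar]
    exact ⟨_, rfl⟩
  have h1 := hq _ hf
  rw [map_mul, map_mul, map_mul, map_mul, map_mul, map_mul, map_inv, map_inv, map_inv, map_inv, hb,
    jacHom_linear, ← hM, GeneralLinearGroup.center_eq_range_scalar] at h1
  obtain ⟨u, hu⟩ := h1
  rw [eq_mul_inv_iff_mul_eq] at hu
  have h2 : GeneralLinearGroup.scalar (Fin n) u * B = M⁻¹ * B * M := hu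
  have h3 := congrArg (fun P : GL (Fin n) ℂ => P.1.trace) h2
  have htr : B.1.trace = n := by
    change t.toMatrix.trace = n
    rw [TransvectionStruct.toMatrix, transvection]
    simp [t.hij]
  -- Conjugate matrices have equal traces, and a transvection has trace n ≠ 0.
  have hu1 : u = 1 := by
    have h4 : (M⁻¹ * B * M).1.trace = B.1.trace := by
      rw [Units.val_mul, trace_mul_comm, ← Units.val_mul, mul_inv_cancel_left]
    have h5 : (GeneralLinearGroup.scalar (Fin n) u * B).1.trace = u * B.1.trace := by
      rw [Units.val_mul, GeneralLinearGroup.coe_scalar, scalar_apply, ← smul_one_eq_diagonal]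
      simp
    simp only [h4, h5, htr] at h3
    refine Units.ext (mul_right_cancel₀ (b := (n : ℂ)) (by exact_mod_cast hn.ne') ?_)
    rw [h3, Units.val_one, one_mul]
  rw [hu1, map_one, one_mul, mul_assoc, eq_inv_mul_iff_mul_eq] at h2
  exact (congrArg Units.val h2).symm

theorem exists_jacobian_apply_dilation (hn : 0 < n) (σ : MulAut (FormalDiffeo n)) :
    ∃ u : ℂˣ, jacobian (σ (dilation n)).toTuple = (u : ℂ) • 1 := by
  have h := jacHom_apply_dilation_mem_center hn σ
  rw [GeneralLinearGroup.center_eq_range_scalar] at h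
  obtain ⟨u, hu⟩ := h
  refine ⟨u, ?_⟩
  rw [← val_jacHom, ← hu, GeneralLinearGroup.coe_scalar, scalar_apply, ← smul_one_eq_diagonal]

/-- Automorphisms preserve the subgroup of diffeomorphisms tangent to the identity. -/
theorem apply_mem_congSubgroup_two (hn : 0 < n) (σ : MulAut (FormalDiffeo n)) {f : FormalDiffeo n}
    (hf : f ∈ congSubgroup n 2) : σ f ∈ congSubgroup n 2 := by
  obtain ⟨g, -, hg⟩ := exists_mul_eq le_rfl (jacobian_homothety _) hf
    (fun d hd => by simpa using two_pow_ne hd) (h := dilation n)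
  have hc := jacHom_apply_dilation_mem_center hn σ
  rw [mem_congSubgroup_two]
  have := congrArg (fun x => jacHom n (σ x)) hg
  simp only [map_mul] at this
  rw [Subgroup.mem_center_iff.1 hc, mul_assoc] at this
  simpa using this

/-- In degree two the equation reads 2(f₂ + 2g₂) = 4g₂, whence f₂ = 0: the resonance 2² = 2 · 2 is
the obstruction. -/
theorem mem_congSubgroup_three_of_mul {f g : FormalDiffeo n} (hf : f ∈ congSubgroup n 2)
    (hg : g ∈ congSubgroup n 2) (h : dilation n * f * (g * g) = g * dilation n) :
    f ∈ congSubgroup n 3 := by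
  rw [mem_congSubgroup_three hf]
  funext i
  ext j k
  have h1 := congrArg (fun x : FormalDiffeo n =>
    coeff (Finsupp.single j 1 + Finsupp.single k 1) (x.toTuple i)) h
  simp only [mul_assoc (dilation n), coeff_homothety_mul, coeff_mul_homothety] at h1
  have h2 := congrFun (congrFun (congrFun (hess_mul hf (mul_mem hg hg)) i) j) k
  rw [hess_mul hg hg] at h2
  simp only [Pi.add_apply, Matrix.add_apply, hess_apply] at h2
  rw [hess_apply]
  change _ = (0 : ℂ)
  simp only [map_add, Finsupp.degree_single, Units.val_mk0] at h1
  have h3 : coeff (Finsupp.single j 1 + Finsupp.single k 1) (g.toTuple i) * 4 =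
      2 * coeff (Finsupp.single j 1 + Finsupp.single k 1) ((f * (g * g)).toTuple i) := by
    rw [h1]
    ring
  linear_combination -h2 - (if j = k then 1 else 1 / 2) * h3 / 2

theorem exists_mem_not_mem (hn : 0 < n) :
    ∃ f : FormalDiffeo n, f ∈ congSubgroup n 2 ∧ f ∉ congSubgroup n 3 := by
  let i : Fin n := ⟨0, hn⟩
  refine ⟨ofQuad (tens 1 1 1), ofQuad_mem _, ?_⟩
  rw [mem_congSubgroup_three (ofQuad_mem _)]
  intro h
  have := congrFun (congrFun (congrFun h i) i) i
  rw [hess_ofQuad] at this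
  simp [tens] at this

/-- The ratio of the image of the dilation is a root of two. -/
theorem exists_pow_eq_two (hn : 0 < n) (σ : MulAut (FormalDiffeo n)) {u : ℂˣ}
    (hu : jacobian (σ (dilation n)).toTuple = (u : ℂ) • 1) : ∃ k : ℕ, 1 ≤ k ∧ (u : ℂ) ^ k = 2 := by
  by_contra! hcon
  obtain ⟨f, hf, hf'⟩ := exists_mem_not_mem hn
  -- A resonance u ^ (k + 1) = 2u would mean u ^ k = 2. Without one the equation is solvable for σ
  -- f, and pulling it back by σ⁻¹ deprives f of its quadratic part.
  obtain ⟨g, hg, h⟩ := exists_mul_sq_eq le_rfl hu (apply_mem_congSubgroup_two hn σ hf)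
    (fun d hd heq => by
      obtain ⟨k, rfl⟩ : ∃ k, d = k + 1 := ⟨d - 1, by omega⟩
      rw [pow_succ'] at heq
      exact hcon k (by omega) (mul_left_cancel₀ u.ne_zero heq))
  have hg' := apply_mem_congSubgroup_two hn σ⁻¹ hg
  refine hf' (mem_congSubgroup_three_of_mul hf hg' ?_)
  apply σ.injective
  simpa using h

/-- Let u and v be the ratios for σ and σ⁻¹, with u^k = 2 and v^l = 2. Then σ⁻¹(δ) is conjugate to
the homothety of ratio v, whose l-th power is δ. Applying σ, σ(δ) is conjugate to δ^l, so u = 2^l;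
hence kl = 1 and u = 2. -/
theorem jacobian_apply_dilation (hn : 0 < n) (σ : MulAut (FormalDiffeo n)) :
    jacobian (σ (dilation n)).toTuple = (2 : ℂ) • 1 := by
  obtain ⟨u, hu⟩ := exists_jacobian_apply_dilation hn σ
  obtain ⟨v, hv⟩ := exists_jacobian_apply_dilation hn σ⁻¹
  obtain ⟨k, hk, huk⟩ := exists_pow_eq_two hn σ hu
  obtain ⟨l, hl, hvl⟩ := exists_pow_eq_two hn σ⁻¹ hv
  obtain ⟨g, hg⟩ := exists_conj_eq_homothety hv (fun d hd heq => by
    obtain ⟨j, rfl⟩ : ∃ j, d = j + 1 := ⟨d - 1, by omega⟩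
    have h1 : (v : ℂ) ^ j = 1 := by
      rw [pow_succ] at heq
      exact mul_right_cancel₀ v.ne_zero (by rw [heq, one_mul])
    have h2 : (2 : ℂ) ^ (j + 1) = 2 := by
      rw [← hvl, pow_succ, ← pow_mul, mul_comm l j, pow_mul, h1, one_pow, one_mul]
    exact two_pow_ne (by omega) h2)
  have hpow : ∀ (w : ℂˣ) (m : ℕ), homothety n w ^ m = homothety n (w ^ m) := by
    intro w m
    rw [homothety, homothety, ← map_pow, ← map_pow]
  have h1 : (g * σ⁻¹ (dilation n) * g⁻¹) ^ l = dilation n := by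
    rw [hg, hpow]
    congr 1
    exact Units.ext hvl
  rw [conj_pow] at h1
  have h2 := congrArg (fun x => jacHom n (σ x)) h1
  simp only [map_mul, map_pow, map_inv, MulAut.apply_inv_self] at h2
  have h3 : jacHom n (dilation n) ^ l ∈ Subgroup.center (GL (Fin n) ℂ) := by
    refine Subgroup.pow_mem _ ?_ l
    rw [dilation, homothety, jacHom_linear, GeneralLinearGroup.center_eq_range_scalar]
    exact ⟨_, rfl⟩
  rw [Subgroup.mem_center_iff.1 h3, mul_inv_cancel_right] at h2
  have h4 : ((2 : ℂ) ^ l) • (1 : Matrix (Fin n) (Fin n) ℂ) = (u : ℂ) • 1 := by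
    rw [← hu, ← val_jacHom, ← h2, Units.val_pow_eq_pow_val, val_jacHom, jacobian_homothety, smul_pow,
      one_pow]
    rfl
  have h5 : (2 : ℂ) ^ l = u := by
    simpa using congrFun (congrFun h4 ⟨0, hn⟩) ⟨0, hn⟩
  have h6 : l * k = 1 := two_pow_eq (by rw [pow_mul, h5, huk])
  rw [hu, ← huk, Nat.eq_one_of_mul_eq_one_left h6, pow_one]

theorem exists_conj_apply_dilation (hn : 0 < n) (σ : MulAut (FormalDiffeo n)) :
    ∃ g : FormalDiffeo n, g * σ (dilation n) * g⁻¹ = dilation n :=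
  exists_conj_eq_homothety (jacobian_apply_dilation hn σ) fun d hd => by simpa using two_pow_ne hd

/-- Commutation multiplies a coefficient of degree d by 2^d on one side and by 2 on the other, so
only d = 1 survives. -/
theorem eq_linear_of_commute {f : FormalDiffeo n} (h : f * dilation n = dilation n * f) :
    f = linear n (jacHom n f) := by
  refine FormalDiffeo.ext (funext fun i => ?_)
  ext e
  have h1 := congrArg (fun x : FormalDiffeo n => coeff e (x.toTuple i)) h
  simp only [coeff_homothety_mul, coeff_mul_homothety, Units.val_mk0] at h1
  by_cases he : e.degree = 1
  · obtain ⟨j, e', he', rfl⟩ := exists_eq_single_add he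
    obtain rfl := (Finsupp.degree_eq_zero_iff e').1 he'
    rw [add_zero]
    change (jacHom n f).1 i j = (jacHom n (linear n (jacHom n f))).1 i j
    rw [jacHom_linear]
  · have hz : ∀ p : ℂ, (2 : ℂ) ^ e.degree * p = 2 * p → p = 0 := by
      intro p hp
      by_contra hne
      exact he (two_pow_eq (mul_right_cancel₀ hne hp))
    have h2 := congrArg (fun x : FormalDiffeo n => coeff e (x.toTuple i))
      (linear_mul_homothety (Units.mk0 2 two_ne_zero) (jacHom n f))
    simp only [coeff_homothety_mul, coeff_mul_homothety, Units.val_mk0] at h2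
    rw [hz _ h1, hz _ h2]

end FormalDiffeo

end

/-! ### Induced actions on homotheties, quadratic parts and linear maps -/

noncomputable section

namespace FormalDiffeo

open MvPowerSeries FormalTuple BilinTuple Matrix

variable {n : ℕ}

theorem homothety_injective (hn : 0 < n) : Function.Injective (homothety n) := by
  intro u v h
  have h1 : (u : ℂ) • (1 : Matrix (Fin n) (Fin n) ℂ) = (v : ℂ) • 1 := by
    rw [← jacobian_homothety, h, jacobian_homothety]
  exact Units.ext (by simpa using congrFun (congrFun h1 ⟨0, hn⟩) ⟨0, hn⟩)

theorem fieldAut_homothety (τ : ℂ ≃+* ℂ) (u : ℂˣ) :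
    fieldAut n τ (homothety n u) = homothety n (Units.map (τ : ℂ →* ℂ) u) := by
  refine FormalDiffeo.ext (funext fun i => ?_)
  change MvPowerSeries.map (τ : ℂ →+* ℂ) ((homothety n u).toTuple i) = _
  rw [toTuple_homothety, toTuple_homothety]
  simp [smul_eq_C_mul]

/-- The restriction of an automorphism to linear maps, followed by the linear part. -/
def linearAut (σ : MulAut (FormalDiffeo n)) : GL (Fin n) ℂ →* GL (Fin n) ℂ :=
  (jacHom n).comp (σ.toMonoidHom.comp (linear n))

/-- The map induced by an automorphism on quadratic parts. -/
def quadAut (σ : MulAut (FormalDiffeo n)) (w : BilinTuple n) : BilinTuple n :=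
  hess (σ (ofQuad w))

variable {σ : MulAut (FormalDiffeo n)}

theorem apply_linear (hσ : σ (dilation n) = dilation n) (A : GL (Fin n) ℂ) :
    σ (linear n A) = linear n (linearAut σ A) := by
  refine eq_linear_of_commute ?_
  nth_rw 1 [← hσ]
  nth_rw 2 [← hσ]
  rw [← map_mul, ← map_mul, linear_mul_homothety]

theorem inv_apply_dilation (hσ : σ (dilation n) = dilation n) :
    σ⁻¹ (dilation n) = dilation n :=
  σ.injective (by rw [MulAut.apply_inv_self, hσ])

/-- Homotheties form the centre of GL, and σ restricts to an automorphism of GL. -/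
theorem exists_apply_homothety (hσ : σ (dilation n) = dilation n) (u : ℂˣ) :
    ∃ v, σ (homothety n u) = homothety n v := by
  have hc : linearAut σ (GeneralLinearGroup.scalar (Fin n) u) ∈ Subgroup.center (GL (Fin n) ℂ) := by
    rw [Subgroup.mem_center_iff]
    intro A
    have h1 := apply_linear (inv_apply_dilation hσ) A
    have h2 := congrArg (fun f => jacHom n (σ f))
      (linear_mul_homothety u (linearAut σ⁻¹ A))
    simp only [map_mul, ← h1, MulAut.apply_inv_self, jacHom_linear] at h2
    exact h2
  rw [GeneralLinearGroup.center_eq_range_scalar] at hc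
  obtain ⟨v, hv⟩ := hc
  refine ⟨v, ?_⟩
  rw [homothety, apply_linear hσ, ← hv, homothety]

/-- Solvability of δ f g² = g δ characterizes `congSubgroup n 3` inside `congSubgroup n 2`, and σ
preserves this equation since it fixes δ. -/
theorem apply_mem_congSubgroup_three (hn : 0 < n) (hσ : σ (dilation n) = dilation n)
    {f : FormalDiffeo n} (hf : f ∈ congSubgroup n 3) : σ f ∈ congSubgroup n 3 := by
  have h23 : congSubgroup n 3 ≤ congSubgroup n 2 := congSubgroup_mono (by norm_num)
  obtain ⟨g, hg, h⟩ := exists_mul_sq_eq (by norm_num) (jacobian_homothety _) hf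
    (h := dilation n) (fun d hd heq => by
      obtain ⟨k, rfl⟩ : ∃ k, d = k + 1 := ⟨d - 1, by omega⟩
      rw [pow_succ', Units.val_mk0] at heq
      have := two_pow_eq (mul_left_cancel₀ two_ne_zero heq)
      omega)
  refine mem_congSubgroup_three_of_mul (g := σ g) (apply_mem_congSubgroup_two hn σ (h23 hf))
    (apply_mem_congSubgroup_two hn σ (h23 hg)) ?_
  have := congrArg σ h
  simpa only [map_mul, hσ] using this

theorem hess_apply_eq (hn : 0 < n) (hσ : σ (dilation n) = dilation n) {f g : FormalDiffeo n}
    (hf : f ∈ congSubgroup n 2) (hg : g ∈ congSubgroup n 2) (h : hess f = hess g) :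
    hess (σ f) = hess (σ g) := by
  rw [hess_eq_iff (apply_mem_congSubgroup_two hn σ hf) (apply_mem_congSubgroup_two hn σ hg),
    ← map_inv, ← map_mul]
  exact apply_mem_congSubgroup_three hn hσ ((hess_eq_iff hf hg).1 h)

theorem quadAut_hess (hn : 0 < n) (hσ : σ (dilation n) = dilation n) {f : FormalDiffeo n}
    (hf : f ∈ congSubgroup n 2) : quadAut σ (hess f) = hess (σ f) :=
  hess_apply_eq hn hσ (ofQuad_mem _) hf (hess_ofQuad_hess f)

theorem quadAut_add (hn : 0 < n) (hσ : σ (dilation n) = dilation n) (w w' : BilinTuple n) :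
    quadAut σ (w + w') = quadAut σ w + quadAut σ w' := by
  rw [quadAut, quadAut, quadAut, ← hess_mul (apply_mem_congSubgroup_two hn σ (ofQuad_mem _))
    (apply_mem_congSubgroup_two hn σ (ofQuad_mem _)), ← map_mul]
  refine hess_apply_eq hn hσ (ofQuad_mem _) (mul_mem (ofQuad_mem _) (ofQuad_mem _)) ?_
  rw [hess_mul (ofQuad_mem _) (ofQuad_mem _)]
  funext i
  ext j k
  rw [Pi.add_apply, Matrix.add_apply, hess_ofQuad, hess_ofQuad, hess_ofQuad, Pi.add_apply,
    Matrix.add_apply, Matrix.add_apply]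
  ring

theorem quadAut_act (hn : 0 < n) (hσ : σ (dilation n) = dilation n) (A : GL (Fin n) ℂ)
    (w : BilinTuple n) : quadAut σ (act A w) = act (linearAut σ A) (quadAut σ w) := by
  rw [quadAut, ← linear_conj_ofQuad, map_mul, map_mul, map_inv, apply_linear hσ,
    hess_conj (apply_mem_congSubgroup_two hn σ (ofQuad_mem _))]
  rfl

/-- The homothety of ratio u carries u w to w, and its image carries `quadAut σ (u • w)` to v⁻¹
times itself. -/
theorem quadAut_smul (hn : 0 < n) (hσ : σ (dilation n) = dilation n) {u v : ℂˣ}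
    (h : σ (homothety n u) = homothety n v) (w : BilinTuple n) :
    quadAut σ ((u : ℂ) • w) = (v : ℂ) • quadAut σ w := by
  have h1 := quadAut_act hn hσ (GeneralLinearGroup.scalar (Fin n) u) ((u : ℂ) • w)
  have h2 : linearAut σ (GeneralLinearGroup.scalar (Fin n) u) =
      GeneralLinearGroup.scalar (Fin n) v := by
    change jacHom n (σ (homothety n u)) = _
    rw [h, homothety, jacHom_linear]
  rw [h2, act_scalar, act_scalar, smul_smul, Units.inv_mul, one_smul] at h1
  rw [h1, smul_smul, Units.mul_inv, one_smul]

theorem quadAut_tens_symm (hn : 0 < n) (hσ : σ (dilation n) = dilation n) (v l m : Fin n → ℂ) :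
    quadAut σ (tens v l m) = quadAut σ (tens v m l) := by
  refine hess_apply_eq hn hσ (ofQuad_mem _) (ofQuad_mem _) ?_
  funext i
  ext j k
  rw [hess_ofQuad, hess_ofQuad]
  simp only [tens, Matrix.smul_apply, vecMulVec_apply, smul_eq_mul]
  ring

theorem exists_quadAut_eq_hess (hn : 0 < n) (hσ : σ (dilation n) = dilation n) {f : FormalDiffeo n}
    (hf : f ∈ congSubgroup n 2) : ∃ w, quadAut σ w = hess f :=
  ⟨hess (σ⁻¹ f), by
    rw [quadAut_hess hn hσ (apply_mem_congSubgroup_two hn _ hf), MulAut.apply_inv_self]⟩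

/-- An automorphism which fixes the dilation acts on homotheties through a field automorphism. -/
theorem exists_fieldAut (hn : 0 < n) (hσ : σ (dilation n) = dilation n) :
    ∃ τ : ℂ ≃+* ℂ, ∀ u : ℂˣ,
      σ (homothety n u) = homothety n (Units.map (τ : ℂ →* ℂ) u) := by
  choose φ hφ using exists_apply_homothety hσ
  let t : ℂ → ℂ := fun z => if h : z = 0 then 0 else φ (Units.mk0 z h)
  have htu : ∀ u : ℂˣ, t u = φ u := by
    intro u
    simp [t]
  have ht0 : t 0 = 0 := by simp [t]
  have ht : ∀ z w, quadAut σ (z • w) = t z • quadAut σ w := by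
    intro z w
    by_cases hz : z = 0
    · subst hz
      have := quadAut_add hn hσ 0 0
      rw [add_zero, left_eq_add] at this
      rw [ht0, zero_smul, zero_smul, this]
    · have := quadAut_smul hn hσ (hφ (Units.mk0 z hz)) w
      rwa [← htu] at this
  -- A nonzero value of `quadAut σ` lets the ring identities for t be checked after acting on it and
  -- then cancelled.
  obtain ⟨f, hf, hf'⟩ := exists_mem_not_mem hn
  obtain ⟨w, hw⟩ := exists_quadAut_eq_hess hn hσ hf
  have hw0 : quadAut σ w ≠ 0 := by
    rw [hw]
    exact fun h => hf' ((mem_congSubgroup_three hf).2 h)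
  have inj := smul_left_injective ℂ hw0
  let T : ℂ →+* ℂ :=
    { toFun := t
      map_zero' := ht0
      map_one' := inj (by
        change t 1 • quadAut σ w = (1 : ℂ) • quadAut σ w
        rw [← ht, one_smul, one_smul])
      map_add' := fun x y => inj (by
        change t (x + y) • quadAut σ w = (t x + t y) • quadAut σ w
        rw [← ht, add_smul, quadAut_add hn hσ, ht, ht, add_smul])
      map_mul' := fun x y => inj (by
        change t (x * y) • quadAut σ w = (t x * t y) • quadAut σ w
        rw [← ht, mul_smul, ht, ht, mul_smul]) }
  have hT : Function.Bijective T := by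
    refine ⟨T.injective, fun y => ?_⟩
    by_cases hy : y = 0
    · exact ⟨0, by rw [hy, map_zero]⟩
    · obtain ⟨v, hv⟩ := exists_apply_homothety (inv_apply_dilation hσ) (Units.mk0 y hy)
      refine ⟨v, ?_⟩
      change t v = y
      rw [htu]
      have h1 : σ (homothety n v) = homothety n (Units.mk0 y hy) := by
        rw [← hv, MulAut.apply_inv_self]
      rw [homothety_injective hn ((hφ v).symm.trans h1), Units.val_mk0]
  refine ⟨RingEquiv.ofBijective T hT, fun u => ?_⟩
  rw [hφ]
  congr 1
  exact Units.ext (htu u).symm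

/-- An automorphism which fixes the homotheties acts on linear maps by an inner automorphism. -/
theorem exists_conj_linearAut (hn : 0 < n) (h : ∀ u, σ (homothety n u) = homothety n u) :
    ∃ P : GL (Fin n) ℂ, ∀ A, P * linearAut σ A * P⁻¹ = A := by
  have hσ := h (Units.mk0 2 two_ne_zero)
  let β : BilinTuple n →ₗ[ℂ] BilinTuple n :=
    { toFun := quadAut σ
      map_add' := quadAut_add hn hσ
      map_smul' := fun z w => by
        by_cases hz : z = 0
        · subst hz
          have := quadAut_add hn hσ 0 0
          rw [add_zero, left_eq_add] at this
          rw [RingHom.id_apply, zero_smul, zero_smul, this]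
        · exact quadAut_smul hn hσ (h (Units.mk0 z hz)) w }
  refine Equivariant.exists_conj (Θ := (div n).comp β) ?_ ?_ ?_
  · intro A v l m
    rw [← act_tens]
    change div n (quadAut σ _) = div n (quadAut σ _) ᵥ* _
    rw [quadAut_act hn hσ, div_act]
  -- Every quadratic part is attained by `quadAut σ`; the one with all coefficients 1 has trace n ≠
  -- 0.
  · intro h0
    obtain ⟨w, hw⟩ := exists_quadAut_eq_hess hn hσ (ofQuad_mem (n := n) (tens 1 1 1))
    have h1 : div n (quadAut σ w) = 0 := LinearMap.congr_fun h0 w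
    rw [hw] at h1
    have h2 := congrFun h1 ⟨0, hn⟩
    rw [div_apply] at h2
    simp only [hess_ofQuad] at h2
    simp [tens] at h2
    exact hn.ne' h2
  · intro v l m
    exact congrArg (div n) (quadAut_tens_symm hn hσ v l m)

end FormalDiffeo

end

theorem mainTheorem10 (n : ℕ) (hn : 0 < n) (σ : MulAut (FormalDiffeo n)) :
    ∃ (g : FormalDiffeo n) (τ : ℂ ≃+* ℂ), ∀ A : Matrix.GeneralLinearGroup (Fin n) ℂ,
      MulAut.conj g (FormalDiffeo.fieldAut n τ (σ (FormalDiffeo.linear n A))) =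
        FormalDiffeo.linear n A := by
  obtain ⟨g, hg⟩ := FormalDiffeo.exists_conj_apply_dilation hn σ
  -- The automorphism is first conjugated to fix the dilation; the field automorphism by which it
  -- then acts on ratios is undone by τ⁻¹.
  obtain ⟨τ, hτ⟩ := FormalDiffeo.exists_fieldAut (σ := MulAut.conj g * σ) hn hg
  have hfix : ∀ u, (FormalDiffeo.fieldAut n τ.symm * (MulAut.conj g * σ))
      (FormalDiffeo.homothety n u) = FormalDiffeo.homothety n u := by
    intro u
    rw [MulAut.mul_apply, hτ, FormalDiffeo.fieldAut_homothety]
    congr 1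
    exact Units.ext (τ.symm_apply_apply u)
  obtain ⟨P, hP⟩ := FormalDiffeo.exists_conj_linearAut hn hfix
  -- Moving τ⁻¹ past the conjugation by g turns g into τ⁻¹(g); the factor P removes the remaining
  -- inner automorphism of GL.
  refine ⟨FormalDiffeo.linear n P * FormalDiffeo.fieldAut n τ.symm g, τ.symm, fun A => ?_⟩
  have h := FormalDiffeo.apply_linear (hfix (Units.mk0 2 two_ne_zero)) A
  rw [MulAut.mul_apply, MulAut.mul_apply, MulAut.conj_apply, map_mul, map_mul, map_inv] at h
  rw [map_mul, MulAut.mul_apply, MulAut.conj_apply, MulAut.conj_apply, h, ← map_inv, ← map_mul,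
    ← map_mul, hP]
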